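/- Let $\Omega\subset\mathbb R^d$ be a bounded open set (for instance a bounded Lipschitz domain), let $T>0$, and let $H^1_0(\Omega)$ be the closure of $C_c^\infty(\Omega)$ in $H^1(\Omega)$; $(\cdot,\cdot)$ is the inner product of $L^2(\Omega)$ or $L^2(\Omega;\mathbb R^d)$. Assume: 1. $\rho\in C^1([0,T];L^\infty(\Omega))$ with $0<\rho_0\le\rho(t,x)\le\rho_1$ and $|\partial_t\rho(t,x)|\le\rho_1'$; 2. $\eta\in C([0,T];L^\infty(\Omega))$ with $0<\eta_0\le\eta(t,x)\le\eta_1$; 3. $\kappa\in C^1([0,T];L^\infty(\Omega))$ with $0<\kappa_0\le\kappa(t,x)\le\kappa_1$ and $|\partial_t\kappa(t,x)|\le\kappa_1'$; 4. $f:\mathbb R\to\mathbb R$ is Lipschitz continuous; 5. $F\in L^2(0,T;L^2(\Omega))$; 6. $\tilde u_0\in H^1_0(\Omega)$, where $\rho_0,\rho_1,\rho_1',\eta_0,\eta_1,\kappa_0,\kappa_1,\kappa_1'$ are real constants and the bounds in 1--3 hold for all $t\in[0,T]$ and a.e. $x\in\Omega$. Then there is exactly one $u\in C([0,T];H^1_0(\Omega))$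 with weak time derivative $\partial_t u\in L^2(0,T;H^1_0(\Omega))$ and $u(0)=\tilde u_0$ such that, for a.e. $t\in(0,T)$ and all $\varphi\in H^1_0(\Omega)$, $$(\partial_t(\rho u)(t),\varphi)+(\eta(t)\nabla\partial_t u(t),\nabla\varphi)+(\kappa(t)\nabla u(t),\nabla\varphi)=(f(u(t)),\varphi)+(F(t),\varphi),$$ where $\partial_t(\rho u)$ is the weak time derivative of $\rho u:(0,T)\to L^2(\Omega)$. Moreover, $u$ is the limit of the Rothe approximations. For $n\ge1$ put $\tau=T/n$, $t_i=i\tau$, $\rho_i=\rho(t_i)$, $\eta_i=\eta(t_i)$, $\kappa_i=\kappa(t_i)$, $F_i=\frac1\tau\int_{t_{i-1}}^{t_i}F(s)\,ds$ and $\delta z_i=(z_i-z_{i-1})/\tau$. For every $n\ge1$ there are unique $u_0=\tilde u_0$, $u_1,\dots,u_n\in H^1_0(\Omega)$ such that, for $i=1,\dots,n$ and all $\varphi\in H^1_0(\Omega)$, $$(\delta(\rho u)_i,\varphi)+(\eta_i\nabla\delta u_i,\nabla\varphi)+(\kappa_i\nabla u_i,\nabla\varphi)=(f(u_{i-1}),\varphi)+(F_i,\varphi),\qquad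 (\rho u)_i=\rho_iu_i,$$ and the functions $U_n(0)=\tilde u_0$, $U_n(t)=u_{i-1}+(t-t_{i-1})\,\delta u_i$ for $t\in(t_{i-1},t_i]$, converge to $u$ in $C([0,T];L^2(\Omega))$ as $n\to\infty$. -/

import Mathlib

open MeasureTheory Set Filter Topology
open scoped ENNReal NNReal Gradient ContDiff

noncomputable section

namespace PseudoParabolic

/-- The Euclidean space `ℝ^d`. -/
abbrev Rd (d : ℕ) : Type := EuclideanSpace ℝ (Fin d)

/-- `L²(Ω)`. -/
abbrev L2 {d : ℕ} (Ω : Set (Rd d)) : Type := Lp ℝ 2 (volume.restrict Ω)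

/-- `L²(Ω; ℝ^d)`. -/
abbrev L2Vec {d : ℕ} (Ω : Set (Rd d)) : Type := Lp (Rd d) 2 (volume.restrict Ω)

/-- `L^∞(Ω)`. -/
abbrev LInf {d : ℕ} (Ω : Set (Rd d)) : Type := Lp ℝ ∞ (volume.restrict Ω)

/-- The Hilbert space `L²(Ω) × L²(Ω; ℝ^d)` with `‖(v, g)‖² = ‖v‖² + ‖g‖²`. A function of `H¹(Ω)` is
represented in it by the pair of itself and its weak gradient, so that the norm is that of `H¹`. -/
abbrev L2Pair {d : ℕ} (Ω : Set (Rd d)) : Type := WithLp 2 (L2 Ω × L2Vec Ω)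

/-- `φ ∈ C_c^∞(U)`. -/
def IsTestFunction {E : Type*} [NormedAddCommGroup E] [NormedSpace ℝ E]
    (U : Set E) (φ : E → ℝ) : Prop :=
  ContDiff ℝ ∞ φ ∧ HasCompactSupport φ ∧ tsupport φ ⊆ U

/-- `g` is the weak gradient of `v` in `Ω`: for every test function `φ` and every direction `e`,
`∫_Ω v ∂_e φ = - ∫_Ω (g · e) φ`. -/
def HasWeakGradient {d : ℕ} (Ω : Set (Rd d)) (v : L2 Ω) (g : L2Vec Ω) : Prop :=
  ∀ φ : Rd d → ℝ, IsTestFunction Ω φ → ∀ e : Rd d,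
    ∫ x in Ω, v x * fderiv ℝ φ x e = -∫ x in Ω, inner ℝ (g x) e * φ x

/-- The pairs `(φ, ∇φ)` with `φ ∈ C_c^∞(Ω)`. -/
def testPairs {d : ℕ} (Ω : Set (Rd d)) : Submodule ℝ (L2Pair Ω) where
  carrier := {p | ∃ φ : Rd d → ℝ, IsTestFunction Ω φ ∧
    p.fst =ᵐ[volume.restrict Ω] φ ∧ p.snd =ᵐ[volume.restrict Ω] ∇ φ}
  zero_mem' := by
    refine ⟨fun _ => 0, ⟨contDiff_const, HasCompactSupport.zero, ?_⟩, ?_, ?_⟩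
    · have : tsupport (fun _ : Rd d => (0 : ℝ)) = ∅ := tsupport_eq_empty_iff.2 rfl
      simp [this]
    · exact Lp.coeFn_zero _ _ _
    · have h : (∇ (fun _ : Rd d => (0 : ℝ))) = 0 := by
        funext x
        simp [gradient]
      rw [h]
      exact Lp.coeFn_zero _ _ _
  add_mem' := by
    rintro p q ⟨φ, ⟨hφ, hφc, hφs⟩, hp1, hp2⟩ ⟨ψ, ⟨hψ, hψc, hψs⟩, hq1, hq2⟩
    refine ⟨φ + ψ, ⟨hφ.add hψ, hφc.add hψc,
      (tsupport_add φ ψ).trans (union_subset hφs hψs)⟩, ?_, ?_⟩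
    · exact (Lp.coeFn_add p.fst q.fst).trans (hp1.add hq1)
    · have h : ∇ (φ + ψ) = ∇ φ + ∇ ψ := by
        funext x
        have h1 : DifferentiableAt ℝ φ x := hφ.differentiable (by simp) x
        have h2 : DifferentiableAt ℝ ψ x := hψ.differentiable (by simp) x
        simp [gradient, fderiv_add h1 h2]
      rw [h]
      exact (Lp.coeFn_add p.snd q.snd).trans (hp2.add hq2)
  smul_mem' := by
    rintro c p ⟨φ, ⟨hφ, hφc, hφs⟩, hp1, hp2⟩
    refine ⟨c • φ, ⟨hφ.const_smul c, hφc.smul_left (f := fun _ => c),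
      (tsupport_smul_subset_right (fun _ => c) φ).trans hφs⟩, ?_, ?_⟩
    · exact (Lp.coeFn_smul c p.fst).trans (hp1.const_smul c)
    · have h : ∇ (c • φ) = c • ∇ φ := by
        funext x
        have h1 : DifferentiableAt ℝ φ x := hφ.differentiable (by simp) x
        simp [gradient, fderiv_const_smul h1]
      rw [h]
      exact (Lp.coeFn_smul c p.snd).trans (hp2.const_smul c)

/-- `H¹₀(Ω)`: the closure of `C_c^∞(Ω)` in the `H¹` norm. Its elements are pairs of a function and
its weak gradient, see `hasWeakGradient_of_mem_H01`. -/
def H01 {d : ℕ} (Ω : Set (Rd d)) : Submodule ℝ (L2Pair Ω) :=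
  (testPairs Ω).topologicalClosure

/-- The function in `L²(Ω)` underlying an element of `H¹₀(Ω)`. -/
def toL2 {d : ℕ} {Ω : Set (Rd d)} (v : H01 Ω) : L2 Ω := (v : L2Pair Ω).fst

/-- The weak gradient `∇v` of `v ∈ H¹₀(Ω)`. -/
def grad {d : ℕ} {Ω : Set (Rd d)} (v : H01 Ω) : L2Vec Ω := (v : L2Pair Ω).snd

theorem hasWeakGradient_of_mem_testPairs {d : ℕ} {Ω : Set (Rd d)} {p : L2Pair Ω}
    (hp : p ∈ testPairs Ω) : HasWeakGradient Ω p.fst p.snd := by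
  obtain ⟨ψ, ⟨hψ, hψc, hψs⟩, h1, h2⟩ := hp
  rintro φ ⟨hφ, hφc, hφs⟩ e
  have e1 : ∫ x in Ω, p.fst x * fderiv ℝ φ x e = ∫ x, ψ x * fderiv ℝ φ x e := by
    rw [← setIntegral_eq_integral_of_forall_compl_eq_zero (s := Ω) (μ := volume)
      (f := fun x => ψ x * fderiv ℝ φ x e)]
    · refine integral_congr_ae ?_
      filter_upwards [h1] with x hx
      rw [hx]
    · intro x hx
      rw [image_eq_zero_of_notMem_tsupport fun h => hx (hψs h), zero_mul]
  have e2 : ∫ x in Ω, inner ℝ (p.snd x) e * φ x = ∫ x, fderiv ℝ ψ x e * φ x := by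
    rw [← setIntegral_eq_integral_of_forall_compl_eq_zero (s := Ω) (μ := volume)
      (f := fun x => fderiv ℝ ψ x e * φ x)]
    · refine integral_congr_ae ?_
      filter_upwards [h2] with x hx
      rw [hx, inner_gradient_left]
    · intro x hx
      rw [image_eq_zero_of_notMem_tsupport fun h => hx (hφs h), mul_zero]
  have c1 : Continuous fun x => fderiv ℝ ψ x e :=
    (hψ.continuous_fderiv (by simp)).clm_apply continuous_const
  have c2 : Continuous fun x => fderiv ℝ φ x e :=
    (hφ.continuous_fderiv (by simp)).clm_apply continuous_const
  rw [e1, e2]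
  refine integral_mul_fderiv_eq_neg_fderiv_mul_of_integrable ?_ ?_ ?_
    (fun x _ => hψ.differentiable (by simp) x) (fun x _ => hφ.differentiable (by simp) x)
  · exact (c1.mul hφ.continuous).integrable_of_hasCompactSupport hφc.mul_left
  · exact (hψ.continuous.mul c2).integrable_of_hasCompactSupport hψc.mul_right
  · exact (hψ.continuous.mul hφ.continuous).integrable_of_hasCompactSupport hψc.mul_right

theorem hasWeakGradient_of_mem_H01 {d : ℕ} {Ω : Set (Rd d)} (v : H01 Ω) :
    HasWeakGradient Ω (toL2 v) (grad v) := by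
  rintro φ ⟨hφ, hφc, hφs⟩ e
  have c2 : Continuous fun x => fderiv ℝ φ x e :=
    (hφ.continuous_fderiv (by simp)).clm_apply continuous_const
  have k2 : HasCompactSupport fun x => fderiv ℝ φ x e := hφc.fderiv_apply (𝕜 := ℝ) e
  have c3 : Continuous fun x => φ x • e := hφ.continuous.smul continuous_const
  have k3 : HasCompactSupport fun x => φ x • e := hφc.smul_right
  have m2 : MemLp (fun x => fderiv ℝ φ x e) 2 (volume.restrict Ω) :=
    (c2.memLp_of_hasCompactSupport k2).restrict Ω
  have m3 : MemLp (fun x => φ x • e) 2 (volume.restrict Ω) :=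
    (c3.memLp_of_hasCompactSupport k3).restrict Ω
  have i2 : ∀ w : L2 Ω, ∫ x in Ω, w x * fderiv ℝ φ x e = inner ℝ (m2.toLp _) w := by
    intro w
    rw [L2.inner_def]
    refine integral_congr_ae ?_
    filter_upwards [m2.coeFn_toLp] with x hx
    rw [hx]
    simp
  have i3 : ∀ g : L2Vec Ω, ∫ x in Ω, inner ℝ (g x) e * φ x = inner ℝ (m3.toLp _) g := by
    intro g
    rw [L2.inner_def]
    refine integral_congr_ae ?_
    filter_upwards [m3.coeFn_toLp] with x hx
    rw [hx, real_inner_smul_left, real_inner_comm, mul_comm]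
  have hcl : IsClosed
      {p : L2Pair Ω | (inner ℝ (m2.toLp _) p.fst : ℝ) = -inner ℝ (m3.toLp _) p.snd} :=
    isClosed_eq
      (continuous_const.inner (WithLp.fstL 2 ℝ (L2 Ω) (L2Vec Ω)).continuous)
      (continuous_const.inner (WithLp.sndL 2 ℝ (L2 Ω) (L2Vec Ω)).continuous).neg
  have hsub : closure (testPairs Ω : Set (L2Pair Ω)) ⊆
      {p : L2Pair Ω | (inner ℝ (m2.toLp _) p.fst : ℝ) = -inner ℝ (m3.toLp _) p.snd} := by
    refine closure_minimal (fun p hp => ?_) hcl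
    have := hasWeakGradient_of_mem_testPairs hp φ ⟨hφ, hφc, hφs⟩ e
    rw [i2, i3] at this
    exact this
  have hv : (v : L2Pair Ω) ∈ closure (testPairs Ω : Set (L2Pair Ω)) := v.2
  rw [i2, i3]
  exact hsub hv

/-- `w'` is the weak (distributional) derivative on `(0,T)` of the Banach space valued function `w`,
both being Bochner integrable on `(0,T)`. -/
def HasWeakTimeDeriv {E : Type*} [NormedAddCommGroup E] [NormedSpace ℝ E]
    (T : ℝ) (w w' : ℝ → E) : Prop :=
  IntegrableOn w (Ioo 0 T) ∧ IntegrableOn w' (Ioo 0 T) ∧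
    ∀ φ : ℝ → ℝ, IsTestFunction (Ioo 0 T) φ →
      ∫ t in Ioo 0 T, deriv φ t • w t = -∫ t in Ioo 0 T, φ t • w' t

/-- `u` is a weak solution of the direct problem with `u ∈ C([0,T]; H¹₀(Ω))` and
`∂_t u ∈ L²(0,T; H¹₀(Ω))`: here `u'` is `∂_t u` and `w'` is `∂_t (ρ u)`. Only the values of `u` on
`[0,T]` matter. -/
def IsWeakSolution {d : ℕ} (Ω : Set (Rd d)) (T : ℝ) (ρ η κ : ℝ → LInf Ω) (f : ℝ → ℝ)
    (F : ℝ → L2 Ω) (u₀ : H01 Ω) (u : ℝ → H01 Ω) : Prop :=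
  ContinuousOn u (Icc 0 T) ∧ u 0 = u₀ ∧
  ∃ (u' : ℝ → H01 Ω) (w' : ℝ → L2 Ω),
    HasWeakTimeDeriv T u u' ∧ MemLp u' 2 (volume.restrict (Ioo 0 T)) ∧
    HasWeakTimeDeriv T (fun t => (ρ t • toL2 (u t) : L2 Ω)) w' ∧
    ∀ᵐ t ∂(volume.restrict (Ioo 0 T)), ∀ φ : H01 Ω,
      inner ℝ (w' t) (toL2 φ) + inner ℝ (η t • grad (u' t) : L2Vec Ω) (grad φ)
          + inner ℝ (κ t • grad (u t) : L2Vec Ω) (grad φ)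
        = (∫ x in Ω, f (toL2 (u t) x) * toL2 φ x) + inner ℝ (F t) (toL2 φ)

/-- `z 0, …, z n` solve the time-discrete problems with step `τ = T / n`: `z 0 = u₀`, and for
`i = 1, …, n` and all `φ ∈ H¹₀(Ω)`, with `ρ_i = ρ(iτ)` (likewise `η_i`, `κ_i`), with `F_i` the mean
value of `F` over `((i-1)τ, iτ)`, and with `δ z_i = (z_i - z_{i-1}) / τ`,
`(δ(ρ_i z_i), φ) + (η_i ∇δz_i, ∇φ) + (κ_i ∇z_i, ∇φ) = (f(z_{i-1}), φ) + (F_i, φ)`.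
The code writes `i + 1` for `i`. -/
def IsRotheSequence {d : ℕ} (Ω : Set (Rd d)) (T : ℝ) (ρ η κ : ℝ → LInf Ω) (f : ℝ → ℝ)
    (F : ℝ → L2 Ω) (u₀ : H01 Ω) (n : ℕ) (z : ℕ → H01 Ω) : Prop :=
  let τ : ℝ := T / n
  let t : ℕ → ℝ := fun i => i * τ
  z 0 = u₀ ∧
  ∀ i < n, ∀ φ : H01 Ω,
    inner ℝ (τ⁻¹ • ((ρ (t (i + 1)) • toL2 (z (i + 1)) : L2 Ω) - (ρ (t i) • toL2 (z i) : L2 Ω))) (toL2 φ)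
        + inner ℝ (η (t (i + 1)) • grad (τ⁻¹ • (z (i + 1) - z i)) : L2Vec Ω) (grad φ)
        + inner ℝ (κ (t (i + 1)) • grad (z (i + 1)) : L2Vec Ω) (grad φ)
      = (∫ x in Ω, f (toL2 (z i) x) * toL2 φ x)
        + inner ℝ (τ⁻¹ • ∫ s in (t i)..(t (i + 1)), F s) (toL2 φ)

/-- The Rothe function `U_n` on `[0,T]`: with `τ = T / n`, it is `z 0` at `0` and
`z_{i-1} + (t - (i-1)τ) (z_i - z_{i-1}) / τ` for `t ∈ ((i-1)τ, iτ]`. -/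
def rotheFunction {d : ℕ} {Ω : Set (Rd d)} (T : ℝ) (n : ℕ) (z : ℕ → H01 Ω) (t : ℝ) : H01 Ω :=
  let τ : ℝ := T / n
  let i : ℕ := ⌈t / τ⌉₊
  if t ≤ 0 then z 0 else z (i - 1) + (t - ((i : ℝ) - 1) * τ) • (τ⁻¹ • (z i - z (i - 1)))

end PseudoParabolic

end

/-! The term with ∇∂_t u makes the problem an ordinary differential equation with bounded operators.
Let A(t) be the operator on H¹₀(Ω) of the form (ρ v, w) + (η ∇v, ∇w). It is coercive with constant
min ρ₀ η₀, because the H¹ norm is exactly the sum of the two parts, so it is invertible with an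
inverse S(t) continuous in t. Let K, R be the operators of (κ ∇v, ∇w) and (∂_tρ v, w), and let N and
g represent (f(v), ·) and (F, ·). By the product rule for ρu the equation reads u' = S (N u - K u -
R u + g) in H¹₀(Ω), with right-hand side Lipschitz in u and g square integrable in time.

Existence and uniqueness come from a contraction in a weighted sup norm
(`exists_unique_integral_eq`, `exists_unique_evolution`). The integral equation is equivalent to the
weak formulation (`IsWeakSolution.eq_integral`, `isWeakSolution_of_eq_integral`): a continuous
function with integrable weak derivative is its primitive, and `forall_variational_iff` solves the
variational equation for the velocity.

The Rothe scheme is a semi-implicit Euler method for the same equation. Each step is a coercive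
linear problem, hence solvable for every step size. Writing the increment of ρ as the integral of
∂_tρ gives the increment z_{i+1} - z_i as S(t_{i+1}) applied to an integral over the step
(`IsRotheSequence.increment_eq`). F enters it exactly, through its integral, so no time regularity
of F is needed for consistency. Uniform continuity of S, K, u and a discrete Gronwall inequality
give convergence at the nodes (`exists_euler_error_le`), and `norm_rotheFunction_sub_le` carries it
to the interpolants. The convergence obtained is uniform in the H¹ norm, which dominates the L²
norm. -/

namespace PseudoParabolic

/-! ### Gronwall inequality and global Picard iteration -/

/-- A discrete Gronwall inequality for one implicit Euler step. -/
theorem discrete_gronwall {e m : ℕ → ℝ} {x : ℝ} (hx0 : 0 ≤ x) (hx : x ≤ 1 / 2)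
    (hm : ∀ i, 0 ≤ m i) {n : ℕ} (h0 : e 0 ≤ 0)
    (h : ∀ i < n, e (i + 1) ≤ e i + x * (e i + e (i + 1)) + m i) :
    ∀ i ≤ n, e i ≤ 2 * Real.exp (3 * x * i) * ∑ j ∈ Finset.range i, m j := by
  intro i
  induction i with
  | zero => intro _; simpa using h0
  | succ i ih =>
    intro hi
    have h1 := h i (by omega)
    have h2 := ih (by omega)
    set s := ∑ j ∈ Finset.range i, m j with hs
    have hs0 : 0 ≤ s := Finset.sum_nonneg fun j _ => hm j
    -- One step amplifies the error by (1 + x) / (1 - x), which is at most exp (3x) for x ≤ 1/2.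
    have hexp : 1 + x ≤ (1 - x) * Real.exp (3 * x) := by
      have a1 : 1 + 3 * x + (3 * x) ^ 2 / 2 ≤ Real.exp (3 * x) :=
        Real.quadratic_le_exp_of_nonneg (by linarith)
      have a2 : 1 + x ≤ (1 - x) * (1 + 3 * x + (3 * x) ^ 2 / 2) := by
        nlinarith [mul_nonneg hx0 hx0, mul_nonneg (mul_nonneg hx0 hx0) (sub_nonneg.2 hx)]
      exact a2.trans (mul_le_mul_of_nonneg_left a1 (by linarith))
    have hE1 : 1 ≤ Real.exp (3 * x * ((i + 1 : ℕ) : ℝ)) := Real.one_le_exp (by positivity)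
    have hE : Real.exp (3 * x * ((i + 1 : ℕ) : ℝ)) = Real.exp (3 * x * i) * Real.exp (3 * x) := by
      rw [← Real.exp_add]; push_cast; ring_nf
    rw [Finset.sum_range_succ, ← hs]
    have key : (1 - x) * e (i + 1) ≤ (1 - x) *
        (2 * Real.exp (3 * x * ((i + 1 : ℕ) : ℝ)) * (s + m i)) := by
      have b1 : (1 - x) * e (i + 1) ≤ (1 + x) * e i + m i := by linarith
      have b2 : (1 + x) * e i ≤ (1 + x) * (2 * Real.exp (3 * x * i) * s) :=
        mul_le_mul_of_nonneg_left h2 (by linarith)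
      have b3 : (1 + x) * (2 * Real.exp (3 * x * i) * s) ≤
          (1 - x) * Real.exp (3 * x) * (2 * Real.exp (3 * x * i) * s) :=
        mul_le_mul_of_nonneg_right hexp (by positivity)
      -- The factor 2 in the bound absorbs the division of `m i` by 1 - x ≥ 1/2.
      have b4 : m i ≤ (1 - x) * (2 * Real.exp (3 * x * ((i + 1 : ℕ) : ℝ)) * m i) := by
        have : 1 ≤ (1 - x) * (2 * Real.exp (3 * x * ((i + 1 : ℕ) : ℝ))) := by nlinarith
        nlinarith [hm i, mul_le_mul_of_nonneg_right this (hm i)]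
      rw [hE] at b4 ⊢
      nlinarith
    exact le_of_mul_le_mul_left key (by linarith)

theorem continuousOn_comp_of_uncurry {V : Type*} [NormedAddCommGroup V] {T : ℝ} {B : ℝ → V → V}
    (hB : ContinuousOn (Function.uncurry B) (Icc 0 T ×ˢ univ)) {u : ℝ → V}
    (hu : ContinuousOn u (Icc 0 T)) : ContinuousOn (fun s => B s (u s)) (Icc 0 T) :=
  hB.comp (continuousOn_id.prodMk hu) fun _ hs => ⟨hs, mem_univ _⟩

variable {V : Type*} [NormedAddCommGroup V] [NormedSpace ℝ V]

/-- Global solvability of a Carathéodory initial value problem `u' = B(t, u) + h(t)` with `B`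
continuous and Lipschitz in `u`, and `h` integrable, in integral form. -/
theorem exists_unique_integral_eq [CompleteSpace V] {T : ℝ} (hT : 0 < T) {B : ℝ → V → V}
    (hB : ContinuousOn (Function.uncurry B) (Icc 0 T ×ˢ univ)) {C : ℝ}
    (hC : ∀ t ∈ Icc 0 T, ∀ x y, ‖B t x - B t y‖ ≤ C * ‖x - y‖) {h : ℝ → V}
    (hh : IntervalIntegrable h volume 0 T) (u₀ : V) :
    ∃ u : ℝ → V, ContinuousOn u (Icc 0 T) ∧
      (∀ t ∈ Icc 0 T, u t = u₀ + ∫ s in (0 : ℝ)..t, (B s (u s) + h s)) ∧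
      ∀ v : ℝ → V, ContinuousOn v (Icc 0 T) →
        (∀ t ∈ Icc 0 T, v t = u₀ + ∫ s in (0 : ℝ)..t, (B s (v s) + h s)) →
        EqOn v u (Icc 0 T) := by
  -- With k ≥ 2C the Picard map contracts by 1/2 on all of [0,T] in the norm sup e^{-kt}‖u(t)‖,
  -- since e^{-kt} ∫₀ᵗ (k/2) e^{ks} ds ≤ 1/2.
  set k : ℝ := 2 * (|C| + 1) with hk
  have hk0 : 0 < k := by positivity
  have hCk : ∀ t ∈ Icc 0 T, ∀ x y, ‖B t x - B t y‖ ≤ k / 2 * ‖x - y‖ := fun t ht x y =>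
    (hC t ht x y).trans (mul_le_mul_of_nonneg_right (by rw [hk]; linarith [le_abs_self C])
      (norm_nonneg _))
  have hsub : ∀ {t}, t ∈ Icc 0 T → uIcc 0 t ⊆ Icc 0 T := fun {t} ht => by
    rw [uIcc_of_le ht.1]; exact Icc_subset_Icc_right ht.2
  have hint : ∀ {w : ℝ → V}, ContinuousOn w (Icc 0 T) → ∀ {t}, t ∈ Icc 0 T →
      IntervalIntegrable (fun s => B s (w s) + h s) volume 0 t := fun {w} hw {t} ht =>
    (((continuousOn_comp_of_uncurry hB hw).mono (hsub ht)).intervalIntegrable).add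
      (hh.mono_set (by rw [uIcc_of_le hT.le]; exact hsub ht))
  -- The unknown is y = e^{-kt} u, so that the weighted norm of u becomes the plain sup norm of y;
  -- `w y` recovers u.
  let w : C(Icc 0 T, V) → ℝ → V := fun y s => Real.exp (k * s) • IccExtend hT.le y s
  have hw : ∀ y, ContinuousOn (w y) (Icc 0 T) := fun y =>
    ((by fun_prop : Continuous fun s => Real.exp (k * s)).smul
      (y.continuous.Icc_extend' (h := hT.le))).continuousOn
  have hΦc : ∀ y, ContinuousOn (fun t => Real.exp (-(k * t)) •
      (u₀ + ∫ s in (0 : ℝ)..t, (B s (w y s) + h s))) (Icc 0 T) := fun y => by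
    refine ContinuousOn.smul (by fun_prop) (continuousOn_const.add ?_)
    have := intervalIntegral.continuousOn_primitive_interval
      (((intervalIntegrable_iff_integrableOn_Icc_of_le hT.le).1
        (hint (hw y) (right_mem_Icc.2 hT.le))).mono_set (uIcc_of_le hT.le).subset)
    rwa [uIcc_of_le hT.le] at this
  let Φ : C(Icc 0 T, V) → C(Icc 0 T, V) := fun y =>
    ⟨fun t => Real.exp (-(k * t)) • (u₀ + ∫ s in (0 : ℝ)..t, (B s (w y s) + h s)),
      (hΦc y).comp_continuous continuous_subtype_val fun t => t.2⟩
  have hlip : LipschitzWith (1 / 2) Φ := by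
    refine LipschitzWith.of_dist_le_mul fun y y' => ?_
    rw [ContinuousMap.dist_le (by positivity)]
    intro t
    have e1 : Φ y t - Φ y' t = Real.exp (-(k * t)) •
        ∫ s in (0 : ℝ)..t, (B s (w y s) - B s (w y' s)) := by
      simp only [Φ, ContinuousMap.coe_mk]
      rw [← smul_sub, add_sub_add_left_eq_sub,
        ← intervalIntegral.integral_sub (hint (hw y) t.2) (hint (hw y') t.2)]
      simp
    rw [dist_eq_norm, e1, norm_smul, Real.norm_eq_abs, abs_of_pos (Real.exp_pos _)]
    have e2 : ‖∫ s in (0 : ℝ)..t, (B s (w y s) - B s (w y' s))‖ ≤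
        ∫ s in (0 : ℝ)..t, k / 2 * (Real.exp (k * s) * dist y y') := by
      refine intervalIntegral.norm_integral_le_of_norm_le t.2.1
        (Filter.Eventually.of_forall fun s hs => ?_) (Continuous.intervalIntegrable (by fun_prop) _ _)
      have hs' : s ∈ Icc 0 T := ⟨hs.1.le, hs.2.trans t.2.2⟩
      refine (hCk s hs' _ _).trans ?_
      gcongr
      rw [← smul_sub, norm_smul, Real.norm_eq_abs, abs_of_pos (Real.exp_pos _)]
      gcongr
      rw [IccExtend_of_mem _ _ hs', IccExtend_of_mem _ _ hs', ← dist_eq_norm]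
      exact ContinuousMap.dist_apply_le_dist _
    have e3 : ∫ s in (0 : ℝ)..t, k / 2 * (Real.exp (k * s) * dist y y') =
        1 / 2 * dist y y' * (Real.exp (k * t) - 1) := by
      have : ∀ s ∈ uIcc (0 : ℝ) t, HasDerivAt (fun s => 1 / 2 * dist y y' * Real.exp (k * s))
          (k / 2 * (Real.exp (k * s) * dist y y')) s := fun s _ =>
        ((((hasDerivAt_id' s).const_mul k).exp).const_mul (1 / 2 * dist y y')).congr_deriv (by ring)
      rw [intervalIntegral.integral_eq_sub_of_hasDerivAt this
        (Continuous.intervalIntegrable (by fun_prop) _ _)]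
      simp; ring
    calc Real.exp (-(k * t)) * ‖∫ s in (0 : ℝ)..t, (B s (w y s) - B s (w y' s))‖
        ≤ Real.exp (-(k * t)) * (1 / 2 * dist y y' * (Real.exp (k * t) - 1)) := by
          rw [← e3]; gcongr
      _ = 1 / 2 * dist y y' * (1 - Real.exp (-(k * t))) := by
          have : Real.exp (-(k * t)) * Real.exp (k * t) = 1 := by rw [← Real.exp_add]; simp
          linear_combination (1 / 2 * dist y y') * this
      _ ≤ ((1 / 2 : ℝ≥0) : ℝ) * dist y y' := by
          have : 0 ≤ 1 / 2 * dist y y' * Real.exp (-(k * t)) := by positivity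
          push_cast; linarith
  have hcon : ContractingWith (1 / 2) Φ := ⟨by rw [← NNReal.coe_lt_coe]; norm_num, hlip⟩
  -- Solutions of the integral equation correspond to fixed points; one direction gives existence,
  -- the other uniqueness.
  have hfix : ∀ {v : ℝ → V} (hv : ContinuousOn v (Icc 0 T)) (y : C(Icc 0 T, V)),
      (∀ t : Icc 0 T, v t = Real.exp (k * t) • y t) →
      ((∀ t ∈ Icc 0 T, v t = u₀ + ∫ s in (0 : ℝ)..t, (B s (v s) + h s)) ↔
        Function.IsFixedPt Φ y) := by
    intro v hv y hvy
    have e1 : ∀ t ∈ Icc 0 T, ∫ s in (0 : ℝ)..t, (B s (w y s) + h s) =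
        ∫ s in (0 : ℝ)..t, (B s (v s) + h s) := fun t ht => by
      refine intervalIntegral.integral_congr fun s hs => ?_
      have := hvy ⟨s, hsub ht hs⟩
      simp only [w, IccExtend_of_mem _ _ (hsub ht hs)]
      rw [← this]
    have e2 : ∀ t : Icc 0 T, Φ y t = Real.exp (-(k * t)) •
        (u₀ + ∫ s in (0 : ℝ)..t, (B s (v s) + h s)) := fun t => by
      rw [← e1 t t.2]; rfl
    constructor
    · intro H
      ext t
      rw [e2, ← H t t.2, hvy, smul_smul, ← Real.exp_add]
      simp
    · intro H t ht
      have := e2 ⟨t, ht⟩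
      rw [H] at this
      rw [hvy ⟨t, ht⟩, this, smul_smul, ← Real.exp_add]
      simp
  set y := hcon.fixedPoint Φ with hy
  have hyf : Function.IsFixedPt Φ y := hcon.fixedPoint_isFixedPt
  have hwy : ∀ t : Icc 0 T, w y t = Real.exp (k * t) • y t := fun t => by
    simp only [w, IccExtend_of_mem _ _ t.2]
  refine ⟨w y, hw y, (hfix (hw y) y hwy).2 hyf, fun v hv hve t ht => ?_⟩
  let y' : C(Icc 0 T, V) := ⟨fun t => Real.exp (-(k * t)) • v t,
    (by fun_prop : Continuous fun t : Icc 0 T => Real.exp (-(k * t))).smul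
      (hv.comp_continuous continuous_subtype_val fun t => t.2)⟩
  have hvy' : ∀ t : Icc 0 T, v t = Real.exp (k * t) • y' t := fun t => by
    simp only [y', ContinuousMap.coe_mk, smul_smul, ← Real.exp_add]
    simp
  have : y' = y := hcon.fixedPoint_unique ((hfix hv y' hvy').1 hve)
  rw [hvy' ⟨t, ht⟩, this, ← hwy ⟨t, ht⟩]

end PseudoParabolic

/-! ### Convergence of the semi-implicit Euler scheme -/

namespace PseudoParabolic

theorem exists_forall_dist_lt_of_continuousOn_Icc {E : Type*} [NormedAddCommGroup E] {a b : ℝ}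
    {w : ℝ → E} (hw : ContinuousOn w (Icc a b)) {γ : ℝ} (hγ : 0 < γ) :
    ∃ δ > 0, ∀ s ∈ Icc a b, ∀ t ∈ Icc a b, |s - t| < δ → ‖w s - w t‖ ≤ γ := by
  obtain ⟨δ, hδ, H⟩ := Metric.uniformContinuousOn_iff.1
    (isCompact_Icc.uniformContinuousOn_of_continuous hw) γ hγ
  exact ⟨δ, hδ, fun s hs t ht hst => by
    rw [← dist_eq_norm]; exact (H s hs t ht (by rwa [Real.dist_eq])).le⟩

theorem exists_bound_of_continuousOn_Icc {E : Type*} [NormedAddCommGroup E] {a b : ℝ}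
    {w : ℝ → E} (hw : ContinuousOn w (Icc a b)) : ∃ c, 0 ≤ c ∧ ∀ s ∈ Icc a b, ‖w s‖ ≤ c := by
  obtain ⟨c, hc⟩ := isCompact_Icc.exists_bound_of_continuousOn hw
  exact ⟨max c 0, le_max_right _ _, fun s hs => (hc s hs).trans (le_max_left _ _)⟩

variable {V : Type*} [NormedAddCommGroup V] [NormedSpace ℝ V]

/-- The pointwise consistency estimate for one step of the semi-implicit Euler scheme: `x`, `y` are
the old and new iterates, `p`, `v`, `q` the exact solution at the old node, in between and at the
new node, and `b` is the right-hand side at `v`. -/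
theorem norm_euler_increment_sub_le {S S' K K' R : V →L[ℝ] V} {N : V → V} {L : ℝ≥0}
    (hN : LipschitzWith L N) {x y p q v b g : V} {c k r U γ : ℝ}
    (hb : b = N v - K v - R v + g) (hS' : ‖S'‖ ≤ c) (hK' : ‖K'‖ ≤ k) (hR : ‖R‖ ≤ r) (hv : ‖v‖ ≤ U)
    (hc : 0 ≤ c) (hk : 0 ≤ k) (hr : 0 ≤ r)
    (hSS : ‖S' - S‖ ≤ γ) (hKK : ‖K' - K‖ ≤ γ) (hp : ‖p - v‖ ≤ γ) (hq : ‖q - v‖ ≤ γ) :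
    ‖S' (N x - K' y - R x + g) - S b‖ ≤
      c * (L + k + r) * (‖x - p‖ + ‖y - q‖) + γ * (‖b‖ + c * (L + k + r + U)) := by
  have hγ : 0 ≤ γ := (norm_nonneg _).trans hp
  -- The datum `g` is common to both right-hand sides, so it survives only inside (S' - S) b, where
  -- the factor is small.
  have e : S' (N x - K' y - R x + g) - S b =
      (S' - S) b + S' ((N x - N v) - K' (y - v) - (K' - K) v - R (x - v)) := by
    rw [hb]
    simp only [map_sub, map_add, _root_.sub_apply]
    abel
  have hxv : ‖x - v‖ ≤ ‖x - p‖ + γ := by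
    calc ‖x - v‖ = ‖(x - p) + (p - v)‖ := by abel_nf
      _ ≤ _ := (norm_add_le _ _).trans (by gcongr)
  have hyv : ‖y - v‖ ≤ ‖y - q‖ + γ := by
    calc ‖y - v‖ = ‖(y - q) + (q - v)‖ := by abel_nf
      _ ≤ _ := (norm_add_le _ _).trans (by gcongr)
  have h1 : ‖(S' - S) b‖ ≤ γ * ‖b‖ := ContinuousLinearMap.le_of_opNorm_le _ hSS _
  have h2 : ‖N x - N v‖ ≤ L * (‖x - p‖ + γ) :=
    (hN.norm_sub_le x v).trans (by gcongr)
  have h3 : ‖K' (y - v)‖ ≤ k * (‖y - q‖ + γ) :=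
    (ContinuousLinearMap.le_of_opNorm_le _ hK' _).trans (by gcongr)
  have h4 : ‖(K' - K) v‖ ≤ γ * U :=
    (ContinuousLinearMap.le_of_opNorm_le _ hKK _).trans (by gcongr)
  have h5 : ‖R (x - v)‖ ≤ r * (‖x - p‖ + γ) :=
    (ContinuousLinearMap.le_of_opNorm_le _ hR _).trans (by gcongr)
  have h6 : ‖(N x - N v) - K' (y - v) - (K' - K) v - R (x - v)‖ ≤
      L * (‖x - p‖ + γ) + k * (‖y - q‖ + γ) + γ * U + r * (‖x - p‖ + γ) :=
    (norm_sub_le_of_le (norm_sub_le_of_le (norm_sub_le_of_le h2 h3) h4) h5)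
  rw [e]
  have h7 := norm_add_le_of_le h1 ((ContinuousLinearMap.le_of_opNorm_le _ hS' _).trans
    (mul_le_mul_of_nonneg_left h6 hc))
  refine h7.trans ?_
  have : 0 ≤ c * (k * ‖x - p‖ + (L + r) * ‖y - q‖) := by positivity
  nlinarith

/-- Convergence of the semi-implicit Euler scheme at the nodes, uniformly in the node, for
`u' = S (N u - K u - R u + g)`. -/
theorem exists_euler_error_le [CompleteSpace V] {T : ℝ} (hT : 0 < T) {S K R : ℝ → V →L[ℝ] V}
    (hS : ContinuousOn S (Icc 0 T)) (hK : ContinuousOn K (Icc 0 T)) (hR : ContinuousOn R (Icc 0 T))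
    {N : V → V} {L : ℝ≥0} (hN : LipschitzWith L N) {g : ℝ → V}
    (hg : IntervalIntegrable g volume 0 T) {u : ℝ → V} (hu : ContinuousOn u (Icc 0 T))
    (hue : ∀ t ∈ Icc 0 T, u t = u 0 + ∫ s in (0 : ℝ)..t, S s (N (u s) - K s (u s) - R s (u s) + g s))
    {ε : ℝ} (hε : 0 < ε) :
    ∃ n₀ : ℕ, ∀ n ≥ n₀, ∀ z : ℕ → V, z 0 = u 0 →
      (∀ i < n, z (i + 1) - z i = S ((i + 1 : ℕ) * (T / n)) (∫ s in (i * (T / n))..((i + 1 : ℕ) * (T / n)),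
        (N (z i) - K ((i + 1 : ℕ) * (T / n)) (z (i + 1)) - R s (z i) + g s))) →
      ∀ i ≤ n, ‖z i - u (i * (T / n))‖ ≤ ε := by
  obtain ⟨c, hc0, hc⟩ := exists_bound_of_continuousOn_Icc hS
  obtain ⟨k, hk0, hk⟩ := exists_bound_of_continuousOn_Icc hK
  obtain ⟨r, hr0, hr⟩ := exists_bound_of_continuousOn_Icc hR
  obtain ⟨U, hU0, hU⟩ := exists_bound_of_continuousOn_Icc hu
  set b : ℝ → V := fun s => N (u s) - K s (u s) - R s (u s) + g s with hb
  have h00 : uIcc 0 T = Icc 0 T := uIcc_of_le hT.le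
  have hbi : IntervalIntegrable b volume 0 T := by
    refine IntervalIntegrable.add (ContinuousOn.intervalIntegrable ?_) hg
    rw [h00]
    exact ((hN.continuous.comp_continuousOn hu).sub (hK.clm_apply hu)).sub (hR.clm_apply hu)
  have hSb : IntervalIntegrable (fun s => S s (b s)) volume 0 T := by
    rw [intervalIntegrable_iff_integrableOn_Icc_of_le hT.le] at hbi ⊢
    exact (ContinuousLinearMap.id ℝ (V →L[ℝ] V)).integrable_of_bilin_of_bdd_left c
      (hS.aestronglyMeasurable measurableSet_Icc)
      ((ae_restrict_iff' measurableSet_Icc).2 (Eventually.of_forall hc)) hbi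
  set C : ℝ := c * (L + k + r) with hC
  have hC0 : 0 ≤ C := by positivity
  set C' : ℝ := c * (L + k + r + U) with hC'
  have hC'0 : 0 ≤ C' := by positivity
  set m : ℝ → ℝ := fun s => ‖b s‖ + C' with hm
  have hmi : IntervalIntegrable m volume 0 T := hbi.norm.add intervalIntegrable_const
  set M : ℝ := ∫ s in (0 : ℝ)..T, m s with hM
  have hM0 : 0 ≤ M := intervalIntegral.integral_nonneg hT.le fun s _ => by positivity
  -- The Gronwall bound will be 2 exp (3CT) γ M; this choice turns it into ε M / (M + 1) ≤ ε, also
  -- when M = 0.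
  set γ : ℝ := ε / (2 * Real.exp (3 * C * T) * (M + 1)) with hγ
  have hγ0 : 0 < γ := by positivity
  obtain ⟨δ₁, hδ₁, H1⟩ := exists_forall_dist_lt_of_continuousOn_Icc hS hγ0
  obtain ⟨δ₂, hδ₂, H2⟩ := exists_forall_dist_lt_of_continuousOn_Icc hK hγ0
  obtain ⟨δ₃, hδ₃, H3⟩ := exists_forall_dist_lt_of_continuousOn_Icc hu hγ0
  -- Three moduli of continuity at level γ; the last entry forces Cτ ≤ 1/2, as the Gronwall
  -- inequality requires.
  set δ := min (min δ₁ δ₂) (min δ₃ (1 / (2 * (C + 1)))) with hδ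
  have hδ0 : 0 < δ := by positivity
  obtain ⟨n₀, hn₀⟩ := exists_nat_gt (T / δ)
  refine ⟨n₀, fun n hn z hz0 hz => ?_⟩
  have hnT : T / δ < n := hn₀.trans_le (by exact_mod_cast hn)
  have hn0 : (0 : ℝ) < n := (by positivity : 0 < T / δ).trans hnT
  set τ : ℝ := T / n with hτ
  have hτ0 : 0 < τ := by positivity
  have hτδ : τ < δ := by rw [hτ, div_lt_comm₀ hn0 hδ0]; exact hnT
  have hnτ : n * τ = T := by rw [hτ]; field_simp
  have hnode : ∀ i ≤ n, (i : ℝ) * τ ∈ Icc 0 T := fun i hi =>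
    ⟨by positivity, by rw [← hnτ]; gcongr⟩
  have hmono : ∀ i : ℕ, (i : ℝ) * τ ≤ (i + 1 : ℕ) * τ := fun i => by gcongr; simp
  have hsub : ∀ i < n, uIcc (i * τ) ((i + 1 : ℕ) * τ) ⊆ uIcc 0 T := fun i hi => by
    rw [uIcc_of_le (hmono i), h00]
    exact Icc_subset_Icc (hnode i hi.le).1 (hnode (i + 1) hi).2
  have hCτ : C * τ ≤ 1 / 2 := by
    have h1 : τ ≤ 1 / (2 * (C + 1)) := hτδ.le.trans ((min_le_right _ _).trans (min_le_right _ _))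
    calc C * τ ≤ C * (1 / (2 * (C + 1))) := by gcongr
      _ ≤ 1 / 2 := by
        rw [mul_one_div, div_le_div_iff₀ (by positivity) (by norm_num)]; linarith
  set mi : ℕ → ℝ := fun i => if i < n then γ * ∫ s in (i * τ)..((i + 1 : ℕ) * τ), m s else 0 with hmi'
  have hmi0 : ∀ i, 0 ≤ mi i := fun i => by
    simp only [hmi']
    split_ifs
    · exact mul_nonneg hγ0.le (intervalIntegral.integral_nonneg (hmono i) fun s _ => by positivity)
    · exact le_rfl
  have hstep : ∀ i < n, ‖z (i + 1) - u ((i + 1 : ℕ) * τ)‖ ≤ ‖z i - u (i * τ)‖ +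
      C * τ * (‖z i - u (i * τ)‖ + ‖z (i + 1) - u ((i + 1 : ℕ) * τ)‖) + mi i := by
    intro i hi
    have ha := hnode i hi.le
    have hb' := hnode (i + 1) hi
    have hui : u ((i + 1 : ℕ) * τ) - u (i * τ) = ∫ s in (i * τ)..((i + 1 : ℕ) * τ), S s (b s) := by
      rw [hue _ hb', hue _ ha, add_sub_add_left_eq_sub]
      refine intervalIntegral.integral_interval_sub_left ?_ ?_
      · exact hSb.mono_set (by rw [h00, uIcc_of_le hb'.1]; exact Icc_subset_Icc_right hb'.2)
      · exact hSb.mono_set (by rw [h00, uIcc_of_le ha.1]; exact Icc_subset_Icc_right ha.2)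
    set d : ℝ → V := fun s =>
      N (z i) - K ((i + 1 : ℕ) * τ) (z (i + 1)) - R s (z i) + g s with hd
    have hdi : IntervalIntegrable d volume (i * τ) ((i + 1 : ℕ) * τ) := by
      refine IntervalIntegrable.add (ContinuousOn.intervalIntegrable ?_) (hg.mono_set (hsub i hi))
      exact continuousOn_const.sub ((hR.mono (h00 ▸ hsub i hi)).clm_apply continuousOn_const)
    have hzi := hz i hi
    rw [← ContinuousLinearMap.intervalIntegral_comp_comm _ hdi] at hzi
    -- Both increments are integrals over the same step, so the error increment is a single integral
    -- to which the pointwise consistency estimate applies.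
    have hdiff : (z (i + 1) - u ((i + 1 : ℕ) * τ)) - (z i - u (i * τ)) =
        ∫ s in (i * τ)..((i + 1 : ℕ) * τ), (S ((i + 1 : ℕ) * τ) (d s) - S s (b s)) := by
      rw [intervalIntegral.integral_sub _ (hSb.mono_set (hsub i hi)), ← hzi, ← hui]
      · abel
      · exact ⟨(S ((i + 1 : ℕ) * τ)).integrable_comp hdi.1,
          (S ((i + 1 : ℕ) * τ)).integrable_comp hdi.2⟩
    have hmii : IntervalIntegrable m volume (i * τ) ((i + 1 : ℕ) * τ) := hmi.mono_set (hsub i hi)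
    have hbound : ‖∫ s in (i * τ)..((i + 1 : ℕ) * τ), (S ((i + 1 : ℕ) * τ) (d s) - S s (b s))‖ ≤
        ∫ s in (i * τ)..((i + 1 : ℕ) * τ),
          (C * (‖z i - u (i * τ)‖ + ‖z (i + 1) - u ((i + 1 : ℕ) * τ)‖) + γ * m s) := by
      refine intervalIntegral.norm_integral_le_of_norm_le (hmono i)
        (Eventually.of_forall fun s hs => ?_) (intervalIntegrable_const.add (hmii.const_mul _))
      have hs' : s ∈ Icc 0 T := ⟨ha.1.trans hs.1.le, hs.2.trans hb'.2⟩
      have hlen : ((i + 1 : ℕ) : ℝ) * τ - i * τ = τ := by push_cast; ring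
      have d1 : |((i + 1 : ℕ) : ℝ) * τ - s| < δ := by
        rw [abs_of_nonneg (sub_nonneg.2 hs.2)]; linarith [hs.1]
      have d2 : |(i : ℝ) * τ - s| < δ := by
        rw [abs_sub_comm, abs_of_nonneg (sub_nonneg.2 hs.1.le)]; linarith [hs.2]
      exact norm_euler_increment_sub_le hN rfl (hc _ hb') (hk _ hb') (hr _ hs') (hU _ hs')
        hc0 hk0 hr0
        (H1 _ hb' _ hs' (d1.trans_le ((min_le_left _ _).trans (min_le_left _ _))))
        (H2 _ hb' _ hs' (d1.trans_le ((min_le_left _ _).trans (min_le_right _ _))))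
        (H3 _ ha _ hs' (d2.trans_le ((min_le_right _ _).trans (min_le_left _ _))))
        (H3 _ hb' _ hs' (d1.trans_le ((min_le_right _ _).trans (min_le_left _ _))))
    rw [intervalIntegral.integral_add intervalIntegrable_const (hmii.const_mul _),
      intervalIntegral.integral_const, intervalIntegral.integral_const_mul, ← hdiff] at hbound
    have hlen : ((i + 1 : ℕ) : ℝ) * τ - i * τ = τ := by push_cast; ring
    rw [hlen, smul_eq_mul] at hbound
    have htri : ‖z (i + 1) - u ((i + 1 : ℕ) * τ)‖ ≤ ‖z i - u (i * τ)‖ +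
        ‖(z (i + 1) - u ((i + 1 : ℕ) * τ)) - (z i - u (i * τ))‖ := by
      simpa using norm_add_le (z i - u (i * τ))
        ((z (i + 1) - u ((i + 1 : ℕ) * τ)) - (z i - u (i * τ)))
    simp only [hmi', if_pos hi]
    linarith
  intro i hi
  have hG := discrete_gronwall (e := fun i => ‖z i - u (i * τ)‖) (mul_nonneg hC0 hτ0.le) hCτ hmi0
    (by simp [hz0]) hstep i hi
  have hsum : ∑ j ∈ Finset.range i, mi j ≤ γ * M := by
    calc ∑ j ∈ Finset.range i, mi j ≤ ∑ j ∈ Finset.range n, mi j :=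
          Finset.sum_le_sum_of_subset_of_nonneg (Finset.range_subset_range.2 hi) fun j _ _ => hmi0 j
      _ = ∑ j ∈ Finset.range n, γ * ∫ s in (j * τ)..((j + 1 : ℕ) * τ), m s :=
          Finset.sum_congr rfl fun j hj => if_pos (Finset.mem_range.1 hj)
      _ = γ * M := by
          rw [← Finset.mul_sum, intervalIntegral.sum_integral_adjacent_intervals
            (a := fun j : ℕ => (j : ℝ) * τ) fun j hj => hmi.mono_set (hsub j hj), hM, hnτ]
          simp
  have hexp : Real.exp (3 * (C * τ) * i) ≤ Real.exp (3 * C * T) := by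
    have := (hnode i hi).2
    refine Real.exp_le_exp.2 ?_
    calc 3 * (C * τ) * i = 3 * C * (i * τ) := by ring
      _ ≤ _ := by gcongr
  calc ‖z i - u (i * τ)‖ ≤ 2 * Real.exp (3 * (C * τ) * i) * ∑ j ∈ Finset.range i, mi j := hG
    _ ≤ 2 * Real.exp (3 * C * T) * (γ * M) := by
        gcongr
        exact Finset.sum_nonneg fun j _ => hmi0 j
    _ = ε * (M / (M + 1)) := by rw [hγ]; field_simp
    _ ≤ ε := mul_le_of_le_one_right hε.le ((div_le_one (by positivity)).2 (by linarith))

end PseudoParabolic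

/-! ### Weak time derivatives and the product rule -/

namespace PseudoParabolic

section TimeDerivative

variable {E G : Type*} [NormedAddCommGroup E] [NormedSpace ℝ E] [NormedAddCommGroup G]
  [NormedSpace ℝ G]

theorem IsTestFunction.eq_zero_of_notMem {X : Type*} [NormedAddCommGroup X] [NormedSpace ℝ X]
    {U : Set X} {φ : X → ℝ} (hφ : IsTestFunction U φ) {x : X} (hx : x ∉ U) : φ x = 0 :=
  image_eq_zero_of_notMem_tsupport fun h => hx (hφ.2.2 h)

theorem norm_intervalIntegral_clm_apply_le {T c : ℝ} (hT : 0 ≤ T) {Ψ : ℝ → E →L[ℝ] G}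
    (hc : ∀ t ∈ Icc 0 T, ‖Ψ t‖ ≤ c) {w : ℝ → E} (hw : IntervalIntegrable w volume 0 T) :
    ‖∫ t in (0 : ℝ)..T, Ψ t (w t)‖ ≤ c * ∫ t in (0 : ℝ)..T, ‖w t‖ := by
  rw [← intervalIntegral.integral_const_mul]
  refine intervalIntegral.norm_integral_le_of_norm_le hT (Eventually.of_forall fun t ht => ?_)
    (hw.norm.const_mul c)
  exact (Ψ t).le_of_opNorm_le (hc t (Ioc_subset_Icc_self ht)) _

theorem intervalIntegrable_clm_apply {T : ℝ} (hT : 0 ≤ T) {Ψ : ℝ → E →L[ℝ] G}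
    (hΨ : ContinuousOn Ψ (Icc 0 T)) {w : ℝ → E} (hw : IntervalIntegrable w volume 0 T) :
    IntervalIntegrable (fun t => Ψ t (w t)) volume 0 T := by
  obtain ⟨c, -, hc⟩ := exists_bound_of_continuousOn_Icc hΨ
  rw [intervalIntegrable_iff_integrableOn_Icc_of_le hT] at hw ⊢
  exact (ContinuousLinearMap.id ℝ (E →L[ℝ] G)).integrable_of_bilin_of_bdd_left c
    (hΨ.aestronglyMeasurable measurableSet_Icc)
    ((ae_restrict_iff' measurableSet_Icc).2 (Eventually.of_forall hc)) hw

theorem continuousOn_primitive {T : ℝ} (hT : 0 ≤ T) {w : ℝ → E}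
    (hw : IntervalIntegrable w volume 0 T) (x : E) :
    ContinuousOn (fun t => x + ∫ s in (0 : ℝ)..t, w s) (Icc 0 T) := by
  have := intervalIntegral.continuousOn_primitive_interval
    (((intervalIntegrable_iff_integrableOn_Icc_of_le hT).1 hw).mono_set (uIcc_of_le hT).subset)
  rw [uIcc_of_le hT] at this
  exact continuousOn_const.add this

variable [CompleteSpace E] [CompleteSpace G]

/-- Integration by parts for an operator-valued `C¹` function vanishing at the endpoints against a
vector-valued primitive of an integrable function. -/
theorem integral_clm_deriv_apply_primitive {T : ℝ} (hT : 0 < T) {Ψ Ψ' : ℝ → E →L[ℝ] G}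
    (hΨ : ContinuousOn Ψ (Icc 0 T)) (hΨ' : ContinuousOn Ψ' (Icc 0 T))
    (hd : ∀ t ∈ Ioo 0 T, HasDerivAt Ψ (Ψ' t) t) (h0 : Ψ 0 = 0) (h1 : Ψ T = 0)
    {w : ℝ → E} (hw : IntervalIntegrable w volume 0 T) (x : E) :
    ∫ t in (0 : ℝ)..T, Ψ' t (x + ∫ s in (0 : ℝ)..t, w s) = -∫ t in (0 : ℝ)..T, Ψ t (w t) := by
  obtain ⟨c, hc0, hc⟩ := exists_bound_of_continuousOn_Icc hΨ
  obtain ⟨c', hc0', hc'⟩ := exists_bound_of_continuousOn_Icc hΨ'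
  have hu : uIcc 0 T = Icc 0 T := uIcc_of_le hT.le
  have hprim : ∀ {v : ℝ → E}, IntervalIntegrable v volume 0 T →
      IntervalIntegrable (fun t => x + ∫ s in (0 : ℝ)..t, v s) volume 0 T := fun {v} hv =>
    ContinuousOn.intervalIntegrable (by rw [hu]; exact continuousOn_primitive hT.le hv x)
  -- For continuous `v` the primitive is classically differentiable and the fundamental theorem of
  -- calculus applies.
  have key : ∀ v : ℝ → E, Continuous v →
      (∫ t in (0 : ℝ)..T, Ψ' t (x + ∫ s in (0 : ℝ)..t, v s)) + ∫ t in (0 : ℝ)..T, Ψ t (v t) = 0 := by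
    intro v hv
    have hvi := hv.intervalIntegrable (μ := volume) 0 T
    rw [← intervalIntegral.integral_add (intervalIntegrable_clm_apply hT.le hΨ' (hprim hvi))
      (intervalIntegrable_clm_apply hT.le hΨ hvi)]
    rw [intervalIntegral.integral_eq_sub_of_hasDerivAt_of_le hT.le
      (f := fun t => Ψ t (x + ∫ s in (0 : ℝ)..t, v s))
      (hΨ.clm_apply (continuousOn_primitive hT.le hvi x)) (fun t ht => ?_)
      ((intervalIntegrable_clm_apply hT.le hΨ' (hprim hvi)).add
        (intervalIntegrable_clm_apply hT.le hΨ hvi)), h0, h1]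
    · simp
    · exact (hd t ht).clm_apply ((intervalIntegral.integral_hasDerivAt_right
        (hv.intervalIntegrable _ _) (hv.stronglyMeasurableAtFilter _ _) hv.continuousAt).const_add x)
  -- Both integrals depend continuously on the integrand in L¹, so `w` is replaced by a continuous
  -- `v` close to it in L¹; the total error is at most (c'T + c) δ.
  rw [eq_neg_iff_add_eq_zero, ← norm_le_zero_iff]
  refine le_of_forall_pos_le_add fun ε hε => ?_
  set δ := ε / (c' * T + c + 1) with hδ
  have hδ0 : 0 < δ := by positivity
  obtain ⟨v, -, hv, hvc, hvi⟩ :=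
    ((intervalIntegrable_iff_integrableOn_Ioc_of_le hT.le).1 hw).exists_hasCompactSupport_integral_sub_le
      hδ0
  rw [← intervalIntegral.integral_of_le hT.le] at hv
  have hvi' := hvc.intervalIntegrable (μ := volume) 0 T
  have hwv := hw.sub hvi'
  have e1 : (∫ t in (0 : ℝ)..T, Ψ' t (x + ∫ s in (0 : ℝ)..t, w s)) -
      (∫ t in (0 : ℝ)..T, Ψ' t (x + ∫ s in (0 : ℝ)..t, v s)) =
      ∫ t in (0 : ℝ)..T, Ψ' t (∫ s in (0 : ℝ)..t, (w s - v s)) := by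
    rw [← intervalIntegral.integral_sub (intervalIntegrable_clm_apply hT.le hΨ' (hprim hw))
      (intervalIntegrable_clm_apply hT.le hΨ' (hprim hvi'))]
    refine intervalIntegral.integral_congr fun t ht => ?_
    have hs : uIcc 0 t ⊆ uIcc 0 T := uIcc_subset_uIcc_left ht
    rw [← map_sub, add_sub_add_left_eq_sub,
      intervalIntegral.integral_sub (hw.mono_set hs) (hvi'.mono_set hs)]
  have e2 : (∫ t in (0 : ℝ)..T, Ψ t (w t)) - (∫ t in (0 : ℝ)..T, Ψ t (v t)) =
      ∫ t in (0 : ℝ)..T, Ψ t (w t - v t) := by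
    rw [← intervalIntegral.integral_sub (intervalIntegrable_clm_apply hT.le hΨ hw)
      (intervalIntegrable_clm_apply hT.le hΨ hvi')]
    simp only [map_sub]
  have e3 : (∫ t in (0 : ℝ)..T, Ψ' t (x + ∫ s in (0 : ℝ)..t, w s)) + ∫ t in (0 : ℝ)..T, Ψ t (w t) =
      (∫ t in (0 : ℝ)..T, Ψ' t (∫ s in (0 : ℝ)..t, (w s - v s))) +
        ∫ t in (0 : ℝ)..T, Ψ t (w t - v t) := by
    rw [← e1, ← e2, ← sub_zero (_ + _), ← key v hvc]
    abel
  have b2 : ‖∫ t in (0 : ℝ)..T, Ψ t (w t - v t)‖ ≤ c * δ :=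
    (norm_intervalIntegral_clm_apply_le hT.le hc hwv).trans (by gcongr)
  have b1 : ‖∫ t in (0 : ℝ)..T, Ψ' t (∫ s in (0 : ℝ)..t, (w s - v s))‖ ≤ c' * δ * T := by
    refine (intervalIntegral.norm_integral_le_of_norm_le_const (C := c' * δ) fun t ht => ?_).trans
      (by rw [sub_zero, abs_of_pos hT])
    rw [uIoc_of_le hT.le] at ht
    refine (Ψ' t).le_of_opNorm_le_of_le (hc' t (Ioc_subset_Icc_self ht)) ?_
    refine (intervalIntegral.norm_integral_le_integral_norm ht.1.le).trans (le_trans ?_ hv)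
    exact intervalIntegral.integral_mono_interval le_rfl ht.1.le ht.2
      (Eventually.of_forall fun s => norm_nonneg _) hwv.norm
  rw [e3, zero_add]
  calc _ ≤ c' * δ * T + c * δ := norm_add_le_of_le b1 b2
    _ = ε * ((c' * T + c) / (c' * T + c + 1)) := by rw [hδ]; ring
    _ ≤ ε := mul_le_of_le_one_right hε.le ((div_le_one (by positivity)).2 (by linarith))

/-- The product rule for the weak time derivative. -/
theorem hasWeakTimeDeriv_clm_apply {T : ℝ} (hT : 0 < T) {Ψ Ψ' : ℝ → E →L[ℝ] G}
    (hΨ' : ContinuousOn Ψ' (Icc 0 T))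
    (hd : ∀ t ∈ Icc 0 T, HasDerivWithinAt Ψ (Ψ' t) (Icc 0 T) t)
    {u w : ℝ → E} (hw : IntervalIntegrable w volume 0 T) {x : E}
    (hu : ∀ t ∈ Icc 0 T, u t = x + ∫ s in (0 : ℝ)..t, w s) :
    HasWeakTimeDeriv T (fun t => Ψ t (u t)) (fun t => Ψ' t (u t) + Ψ t (w t)) := by
  have hΨ : ContinuousOn Ψ (Icc 0 T) := fun t ht => (hd t ht).continuousWithinAt
  have huc : ContinuousOn u (Icc 0 T) := (continuousOn_primitive hT.le hw x).congr hu
  have hui : IntervalIntegrable u volume 0 T :=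
    ContinuousOn.intervalIntegrable (by rwa [uIcc_of_le hT.le])
  have i1 := intervalIntegrable_clm_apply hT.le hΨ hui
  have i2 := intervalIntegrable_clm_apply hT.le hΨ' hui
  have i3 := intervalIntegrable_clm_apply hT.le hΨ hw
  refine ⟨(intervalIntegrable_iff_integrableOn_Ioo_of_le hT.le).1 i1,
    (intervalIntegrable_iff_integrableOn_Ioo_of_le hT.le).1 (i2.add i3), fun φ hφ => ?_⟩
  have hφd : Continuous (deriv φ) := hφ.1.continuous_deriv (by simp)
  have hφc : Continuous φ := hφ.1.continuous
  have hφ0 : φ 0 = 0 := hφ.eq_zero_of_notMem (by simp)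
  have hφT : φ T = 0 := hφ.eq_zero_of_notMem (by simp)
  -- The scalar test function is absorbed into the operator: φΨ vanishes at both endpoints, and its
  -- derivative contributes the two terms φΨ' and φ'Ψ.
  have main := integral_clm_deriv_apply_primitive hT (Ψ := fun t => φ t • Ψ t)
    (Ψ' := fun t => φ t • Ψ' t + deriv φ t • Ψ t)
    (hφc.continuousOn.smul hΨ) ((hφc.continuousOn.smul hΨ').add (hφd.continuousOn.smul hΨ))
    (fun t ht => ((hφ.1.differentiable (by simp) t).hasDerivAt.smul
      ((hd t (Ioo_subset_Icc_self ht)).hasDerivAt (Icc_mem_nhds ht.1 ht.2))))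
    (by simp [hφ0]) (by simp [hφT]) hw x
  have j1 : IntervalIntegrable (fun t => deriv φ t • Ψ t (u t)) volume 0 T :=
    i1.continuousOn_smul hφd.continuousOn
  have j2 : IntervalIntegrable (fun t => φ t • Ψ' t (u t)) volume 0 T :=
    i2.continuousOn_smul hφc.continuousOn
  have j3 : IntervalIntegrable (fun t => φ t • Ψ t (w t)) volume 0 T :=
    i3.continuousOn_smul hφc.continuousOn
  have main' : (∫ t in (0 : ℝ)..T, (φ t • Ψ' t (u t) + deriv φ t • Ψ t (u t))) =
      -∫ t in (0 : ℝ)..T, φ t • Ψ t (w t) := by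
    refine Eq.trans (intervalIntegral.integral_congr fun t ht => ?_) main
    rw [uIcc_of_le hT.le] at ht
    simp [hu t ht]
  rw [← integral_Ioc_eq_integral_Ioo, ← integral_Ioc_eq_integral_Ioo,
    ← intervalIntegral.integral_of_le hT.le, ← intervalIntegral.integral_of_le hT.le]
  rw [intervalIntegral.integral_add j2 j1] at main'
  simp only [smul_add]
  rw [intervalIntegral.integral_add j2 j3]
  rw [neg_add, ← main']
  abel

end TimeDerivative

end PseudoParabolic

/-! ### Uniqueness of weak derivatives and the du Bois-Reymond lemma -/

namespace PseudoParabolic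

section WeakDerivative

variable {E : Type*} [NormedAddCommGroup E] [NormedSpace ℝ E]

theorem IsTestFunction.setIntegral_eq {U : Set ℝ} {φ : ℝ → ℝ} (hφ : IsTestFunction U φ)
    (w : ℝ → E) : ∫ t in U, φ t • w t = ∫ t, φ t • w t :=
  setIntegral_eq_integral_of_forall_compl_eq_zero fun _ hx => by
    rw [hφ.eq_zero_of_notMem hx, zero_smul]

theorem IsTestFunction.integrableOn_smul {U : Set ℝ} {φ : ℝ → ℝ} (hφ : IsTestFunction U φ)
    {w : ℝ → E} (hw : IntegrableOn w U) : IntegrableOn (fun t => φ t • w t) U := by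
  obtain ⟨c, hc⟩ := hφ.1.continuous.bounded_above_of_compact_support hφ.2.1
  exact hw.bdd_smul c hφ.1.continuous.aestronglyMeasurable (Eventually.of_forall hc)

theorem IsTestFunction.deriv {U : Set ℝ} {φ : ℝ → ℝ} (hφ : IsTestFunction U φ) :
    IsTestFunction U (deriv φ) :=
  ⟨(contDiff_infty_iff_deriv.1 hφ.1).2, hφ.2.1.deriv, (tsupport_deriv_subset (𝕜 := ℝ)).trans hφ.2.2⟩

/-- A test function of mean zero on an interval is the derivative of a test function. -/
theorem IsTestFunction.exists_deriv_eq {T : ℝ} (hT : 0 < T) {χ : ℝ → ℝ}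
    (hχ : IsTestFunction (Ioo 0 T) χ) (h : ∫ t in Ioo 0 T, χ t = 0) :
    ∃ φ, IsTestFunction (Ioo 0 T) φ ∧ _root_.deriv φ = χ := by
  -- Adding the midpoint keeps the set nonempty when χ = 0, so that it has a least and a greatest
  -- element.
  set K := insert (T / 2) (tsupport χ) with hK
  have hKc : IsCompact K := hχ.2.1.isCompact.insert _
  have hKs : K ⊆ Ioo 0 T := insert_subset ⟨by linarith, by linarith⟩ hχ.2.2
  obtain ⟨a, haK, ha⟩ := hKc.exists_isLeast ⟨T / 2, mem_insert _ _⟩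
  obtain ⟨b, hbK, hb⟩ := hKc.exists_isGreatest ⟨T / 2, mem_insert _ _⟩
  have hzero : ∀ t, t ∉ Icc a b → χ t = 0 := fun t ht =>
    image_eq_zero_of_notMem_tsupport fun hs =>
      ht ⟨ha (mem_insert_of_mem _ hs), hb (mem_insert_of_mem _ hs)⟩
  have hc := hχ.1.continuous
  set φ : ℝ → ℝ := fun t => ∫ s in (0 : ℝ)..t, χ s with hφ
  have hd : ∀ t, HasDerivAt φ (χ t) t := fun t => intervalIntegral.integral_hasDerivAt_right
    (hc.intervalIntegrable _ _) (hc.stronglyMeasurableAtFilter _ _) hc.continuousAt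
  have hdφ : _root_.deriv φ = χ := funext fun t => (hd t).deriv
  have hsupp : Function.support φ ⊆ Icc a b := by
    intro t ht
    by_contra hn
    refine ht ?_
    rcases lt_or_ge t a with hta | hta
    · refine intervalIntegral.integral_zero_ae (Eventually.of_forall fun s hs => hzero s fun hs' => ?_)
      have := (mem_uIoc.1 hs)
      rcases this with h' | h'
      · linarith [hs'.1, h'.2]
      · linarith [hs'.1, h'.2, (hKs haK).1]
    -- To the right of the support the primitive equals the full integral, which is zero by
    -- hypothesis.
    · have htb : b < t := lt_of_not_ge fun h' => hn ⟨hta, h'⟩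
      have e1 : ∫ s in (0 : ℝ)..T, χ s = 0 := by
        rw [intervalIntegral.integral_of_le hT.le, integral_Ioc_eq_integral_Ioo, h]
      have e2 : ∫ s in t..T, χ s = 0 := by
        refine intervalIntegral.integral_zero_ae
          (Eventually.of_forall fun s hs => hzero s fun hs' => ?_)
        rcases mem_uIoc.1 hs with h' | h'
        · linarith [hs'.2, h'.1]
        · linarith [hs'.2, h'.1, (hKs hbK).2]
      have := intervalIntegral.integral_add_adjacent_intervals (hc.intervalIntegrable 0 t)
        (hc.intervalIntegrable (μ := volume) t T)
      rw [e1, e2, add_zero] at this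
      exact this
  have hts : tsupport φ ⊆ Icc a b := closure_minimal hsupp isClosed_Icc
  refine ⟨φ, ⟨contDiff_infty_iff_deriv.2 ⟨fun t => (hd t).differentiableAt, hdφ ▸ hχ.1⟩,
    isCompact_Icc.of_isClosed_subset (isClosed_tsupport φ) hts, hts.trans ?_⟩, hdφ⟩
  exact fun t ht => ⟨(hKs haK).1.trans_le ht.1, ht.2.trans_lt (hKs hbK).2⟩

theorem exists_isTestFunction_integral_eq_one {T : ℝ} (hT : 0 < T) :
    ∃ ψ, IsTestFunction (Ioo 0 T) ψ ∧ ∫ t in Ioo 0 T, ψ t = 1 := by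
  let f : ContDiffBump (T / 2) := ⟨T / 8, T / 4, by linarith, by linarith⟩
  have ht : IsTestFunction (Ioo 0 T) (f.normed volume) := by
    refine ⟨f.contDiff_normed, f.hasCompactSupport_normed, ?_⟩
    rw [f.tsupport_normed_eq, Real.closedBall_eq_Icc]
    intro t ht
    have h1 := ht.1
    have h2 := ht.2
    simp only [f] at h1 h2
    exact ⟨by linarith, by linarith⟩
  refine ⟨_, ht, ?_⟩
  have := ht.setIntegral_eq (fun _ => (1 : ℝ))
  simp only [smul_eq_mul, mul_one] at this
  rw [this, f.integral_normed]

variable [CompleteSpace E]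

theorem ae_eq_zero_of_forall_isTestFunction {T : ℝ} {w : ℝ → E} (hw : IntegrableOn w (Ioo 0 T))
    (h : ∀ φ, IsTestFunction (Ioo 0 T) φ → ∫ t in Ioo 0 T, φ t • w t = 0) :
    w =ᵐ[volume.restrict (Ioo 0 T)] 0 := by
  have := isOpen_Ioo.ae_eq_zero_of_integral_contDiff_smul_eq_zero hw.locallyIntegrableOn
    fun g g1 g2 g3 => by
      rw [← IsTestFunction.setIntegral_eq (U := Ioo 0 T) ⟨g1, g2, g3⟩]; exact h g ⟨g1, g2, g3⟩
  exact (ae_restrict_iff' measurableSet_Ioo).2 this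

theorem HasWeakTimeDeriv.ae_eq {T : ℝ} {w w₁ w₂ : ℝ → E} (h₁ : HasWeakTimeDeriv T w w₁)
    (h₂ : HasWeakTimeDeriv T w w₂) : w₁ =ᵐ[volume.restrict (Ioo 0 T)] w₂ := by
  have := ae_eq_zero_of_forall_isTestFunction (h₁.2.1.sub h₂.2.1) fun φ hφ => by
    simp only [Pi.sub_apply, smul_sub]
    rw [integral_sub (hφ.integrableOn_smul h₁.2.1) (hφ.integrableOn_smul h₂.2.1), sub_eq_zero,
      ← neg_inj, ← h₁.2.2 φ hφ, ← h₂.2.2 φ hφ]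
  filter_upwards [this] with t ht
  exact sub_eq_zero.1 ht

/-- The du Bois-Reymond lemma. -/
theorem HasWeakTimeDeriv.exists_ae_eq_const {T : ℝ} (hT : 0 < T) {w : ℝ → E}
    (h : HasWeakTimeDeriv T w 0) : ∃ c, w =ᵐ[volume.restrict (Ioo 0 T)] fun _ => c := by
  obtain ⟨ψ₀, hψ₀, hi⟩ := exists_isTestFunction_integral_eq_one hT
  have hiψ : ∀ {ψ}, IsTestFunction (Ioo 0 T) ψ → IntegrableOn ψ (Ioo 0 T) := fun hψ =>
    (hψ.1.continuous.integrable_of_hasCompactSupport hψ.2.1).integrableOn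
  refine ⟨∫ t in Ioo 0 T, ψ₀ t • w t, ?_⟩
  set c := ∫ t in Ioo 0 T, ψ₀ t • w t with hc
  have hci : IntegrableOn (fun _ : ℝ => c) (Ioo 0 T) := integrableOn_const (by simp)
  have := ae_eq_zero_of_forall_isTestFunction (w := fun t => w t - c) (h.1.sub hci) fun ψ hψ => by
    set m := ∫ t in Ioo 0 T, ψ t with hm
    -- Subtracting a multiple of ψ₀ makes the mean zero, so the result is the derivative of a test
    -- function and can be used in the hypothesis on `w`.
    have hχ : IsTestFunction (Ioo 0 T) (fun t => ψ t - m * ψ₀ t) := by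
      refine ⟨hψ.1.sub (contDiff_const.mul hψ₀.1), hψ.2.1.sub hψ₀.2.1.mul_left, ?_⟩
      refine (tsupport_sub _ _).trans (union_subset hψ.2.2 ?_)
      exact (tsupport_smul_subset_right (fun _ => m) ψ₀).trans hψ₀.2.2
    obtain ⟨φ, hφ, hφd⟩ := hχ.exists_deriv_eq hT (by
      rw [integral_sub (hiψ hψ) ((hiψ hψ₀).const_mul m), integral_const_mul, hi]; simp [hm])
    have := h.2.2 φ hφ
    simp only [hφd, Pi.zero_apply, smul_zero, integral_zero, neg_zero, sub_smul, mul_smul] at this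
    have hmi : Integrable (fun t => m • ψ₀ t • w t) (volume.restrict (Ioo 0 T)) :=
      Integrable.smul m (hψ₀.integrableOn_smul h.1)
    rw [integral_sub (hψ.integrableOn_smul h.1) hmi,
      integral_smul, ← hc] at this
    simp only [smul_sub]
    rw [integral_sub (hψ.integrableOn_smul h.1) (hψ.integrableOn_smul hci), integral_smul_const]
    exact this
  filter_upwards [this] with t ht
  exact sub_eq_zero.1 ht

/-- A continuous function with an integrable weak derivative is its primitive. -/
theorem HasWeakTimeDeriv.eq_primitive {T : ℝ} (hT : 0 < T) {u w : ℝ → E}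
    (hu : ContinuousOn u (Icc 0 T)) (h : HasWeakTimeDeriv T u w) :
    ∀ t ∈ Icc 0 T, u t = u 0 + ∫ s in (0 : ℝ)..t, w s := by
  have hw : IntervalIntegrable w volume 0 T :=
    (intervalIntegrable_iff_integrableOn_Ioo_of_le hT.le).2 h.2.1
  have hp := continuousOn_primitive hT.le hw (u 0)
  -- The primitive of `w` has weak derivative `w` too, by the product rule with the constant
  -- identity; the difference then has weak derivative zero.
  have h2 := hasWeakTimeDeriv_clm_apply hT (Ψ := fun _ => ContinuousLinearMap.id ℝ E)
    (Ψ' := fun _ => 0) continuousOn_const (fun t _ => hasDerivWithinAt_const t _ _) hw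
    (u := fun t => u 0 + ∫ s in (0 : ℝ)..t, w s) (fun t _ => rfl)
  simp only [ContinuousLinearMap.id_apply, _root_.zero_apply, zero_add] at h2
  have h3 : HasWeakTimeDeriv T (fun t => u t - (u 0 + ∫ s in (0 : ℝ)..t, w s)) 0 := by
    refine ⟨h.1.sub h2.1, integrableOn_zero, fun φ hφ => ?_⟩
    simp only [smul_sub]
    rw [integral_sub (hφ.deriv.integrableOn_smul h.1) (hφ.deriv.integrableOn_smul h2.1),
      h.2.2 φ hφ, h2.2.2 φ hφ]
    simp
  obtain ⟨c, hc⟩ := h3.exists_ae_eq_const hT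
  -- Continuity upgrades the a.e. equality to the closed interval, and evaluation at 0 shows that
  -- the constant is zero.
  have hc' := Measure.eqOn_Icc_of_ae_eq volume hT.ne
    (by rwa [← restrict_Ioo_eq_restrict_Icc] : _ =ᵐ[volume.restrict (Icc 0 T)] _)
    (hu.sub hp) continuousOn_const
  have h0 := hc' (left_mem_Icc.2 hT.le)
  simp only [Pi.sub_apply, intervalIntegral.integral_same, add_zero, sub_self] at h0
  intro t ht
  have := hc' ht
  simp only [Pi.sub_apply, ← h0] at this
  exact sub_eq_zero.1 this

end WeakDerivative

end PseudoParabolic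

/-! ### Coercive operators and their inverses -/

namespace PseudoParabolic

section Coercive

theorem inverse_apply_eq_iff {V : Type*} [NormedAddCommGroup V] [NormedSpace ℝ V]
    {A : V →L[ℝ] V} (hA : IsUnit A) {v w : V} :
    Ring.inverse A w = v ↔ A v = w := by
  constructor
  · rintro rfl
    exact DFunLike.congr_fun (Ring.mul_inverse_cancel A hA) w
  · rintro rfl
    exact DFunLike.congr_fun (Ring.inverse_mul_cancel A hA) v

variable {V : Type*} [NormedAddCommGroup V] [InnerProductSpace ℝ V] [CompleteSpace V]

/-- The Lax–Milgram theorem in operator form. -/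
theorem isUnit_of_coercive {A : V →L[ℝ] V} {c : ℝ} (hc : 0 < c)
    (hA : ∀ v, c * ‖v‖ ^ 2 ≤ inner ℝ (A v) v) : IsUnit A := by
  lift c to ℝ≥0 using hc.le
  exact ContinuousLinearMap.isUnit_of_forall_le_norm_inner_map A (by exact_mod_cast hc) fun v => by
    rw [mul_comm, Real.norm_eq_abs]
    exact (hA v).trans (le_abs_self _)

/-- Inversion in a Banach algebra is continuous at units; the total function `Ring.inverse` allows
the statement without carrying the units along. -/
theorem continuousOn_inverse {X : Type*} [TopologicalSpace X] {A : X → V →L[ℝ] V} {s : Set X}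
    (hA : ContinuousOn A s) (hu : ∀ t ∈ s, IsUnit (A t)) :
    ContinuousOn (fun t => Ring.inverse (A t)) s := fun t ht => by
  obtain ⟨a, ha⟩ := hu t ht
  have := NormedRing.inverse_continuousAt a
  rw [ha] at this
  exact this.comp_continuousWithinAt (hA t ht)

theorem continuousOn_inverse_add {X : Type*} [TopologicalSpace X] {A B : X → V →L[ℝ] V} {s : Set X}
    (hA : ContinuousOn A s) (hB : ContinuousOn B s) (hu : ∀ t ∈ s, IsUnit (A t + B t)) :
    ContinuousOn (fun t => Ring.inverse (A t + B t)) s :=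
  continuousOn_inverse (hA.add hB) hu

variable {H : Type*} [NormedAddCommGroup H] [InnerProductSpace ℝ H] [CompleteSpace H]

/-- The operator `M ↦ M B`. -/
noncomputable def precompL (B : V →L[ℝ] H) : (H →L[ℝ] H) →L[ℝ] (V →L[ℝ] H) :=
  (ContinuousLinearMap.compL ℝ V H H).flip B

/-- The operator `M ↦ B† M B`. -/
noncomputable def sandwichL (B : V →L[ℝ] H) : (H →L[ℝ] H) →L[ℝ] (V →L[ℝ] V) :=
  (ContinuousLinearMap.compL ℝ V H V B.adjoint) ∘L precompL B

theorem sandwichL_apply (B : V →L[ℝ] H) (M : H →L[ℝ] H) (v : V) :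
    sandwichL B M v = B.adjoint (M (B v)) := rfl

theorem inner_sandwichL (B : V →L[ℝ] H) (M : H →L[ℝ] H) (v w : V) :
    inner ℝ (sandwichL B M v) w = inner ℝ (M (B v)) (B w) := by
  rw [sandwichL_apply, ContinuousLinearMap.adjoint_inner_left]

end Coercive

/-! ### Multiplication and superposition operators on L² -/

section Multiplication

variable {α : Type*} {m : MeasurableSpace α} {μ : Measure α} {E : Type*} [NormedAddCommGroup E]
  [InnerProductSpace ℝ E]

variable (μ E) in
/-- Multiplication of `L²` functions by an `L^∞` function. -/
noncomputable def mulL : Lp ℝ ∞ μ →L[ℝ] Lp E 2 μ →L[ℝ] Lp E 2 μ :=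
  (ContinuousLinearMap.lsmul ℝ ℝ).holderL μ ∞ 2 2

theorem mulL_apply (a : Lp ℝ ∞ μ) (v : Lp E 2 μ) : mulL μ E a v = (a • v : Lp E 2 μ) := by
  refine Lp.ext ?_
  filter_upwards [(ContinuousLinearMap.lsmul ℝ ℝ (E := E)).coeFn_holder (r := 2) a v,
    Lp.coeFn_lpSMul (r := 2) a v] with x h1 h2
  rw [h2]
  exact h1

theorem mul_norm_sq_le_inner_mulL {a : Lp ℝ ∞ μ} {c : ℝ} (h : ∀ᵐ x ∂μ, c ≤ a x) (v : Lp E 2 μ) :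
    c * ‖v‖ ^ 2 ≤ inner ℝ (mulL μ E a v) v := by
  rw [← real_inner_self_eq_norm_sq, L2.inner_def, L2.inner_def, ← integral_const_mul, mulL_apply]
  refine integral_mono_ae ((L2.integrable_inner v v).const_mul c) (L2.integrable_inner _ v) ?_
  filter_upwards [h, Lp.coeFn_lpSMul (r := 2) a v] with x hx h2
  rw [h2, Pi.smul_apply', real_inner_smul_left]
  exact mul_le_mul_of_nonneg_right hx real_inner_self_nonneg

end Multiplication

section Superposition

variable {α : Type*} {m : MeasurableSpace α} {μ : Measure α} [IsFiniteMeasure μ] {f : ℝ → ℝ}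
  {L : ℝ≥0}

/-- From |f(v)| ≤ |f(0)| + L|v|. Finiteness of the measure is what makes the constant |f(0)| square
integrable. -/
theorem memLp_comp_of_lipschitzWith (hf : LipschitzWith L f) (v : Lp ℝ 2 μ) :
    MemLp (fun x => f (v x)) 2 μ := by
  have h0 : MemLp (fun _ : α => |f 0|) 2 μ := memLp_const _
  have h' : MemLp (fun x => (L : ℝ) * ‖v x‖) 2 μ := (Lp.memLp v).norm.const_mul _
  have h : MemLp (fun x => |f 0| + L * ‖v x‖) 2 μ := h0.add h'
  refine h.mono' (hf.continuous.comp_aestronglyMeasurable (Lp.aestronglyMeasurable v))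
    (Eventually.of_forall fun x => ?_)
  have h1 : ‖f (v x) - f 0‖ ≤ L * ‖v x - 0‖ := hf.norm_sub_le (v x) 0
  rw [sub_zero, Real.norm_eq_abs] at h1
  have h2 : |f (v x)| ≤ |f 0| + |f (v x) - f 0| := by simpa using abs_add_le (f 0) (f (v x) - f 0)
  rw [Real.norm_eq_abs]
  linarith

/-- The superposition operator `v ↦ f ∘ v` on `L²`. -/
noncomputable def superposition (hf : LipschitzWith L f) (v : Lp ℝ 2 μ) : Lp ℝ 2 μ :=
  (memLp_comp_of_lipschitzWith hf v).toLp _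

theorem coeFn_superposition (hf : LipschitzWith L f) (v : Lp ℝ 2 μ) :
    superposition hf v =ᵐ[μ] fun x => f (v x) := MemLp.coeFn_toLp _

theorem lipschitzWith_superposition (hf : LipschitzWith L f) :
    LipschitzWith L (superposition (μ := μ) hf) := by
  refine LipschitzWith.of_dist_le_mul fun v w => ?_
  rw [dist_eq_norm, dist_eq_norm]
  refine Lp.norm_le_mul_norm_of_ae_le_mul ?_
  filter_upwards [coeFn_superposition hf v, coeFn_superposition hf w,
    Lp.coeFn_sub (superposition hf v) (superposition hf w), Lp.coeFn_sub v w] with x h1 h2 h3 h4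
  rw [h3, h4, Pi.sub_apply, Pi.sub_apply, h1, h2]
  exact hf.norm_sub_le _ _

theorem inner_superposition (hf : LipschitzWith L f) (v w : Lp ℝ 2 μ) :
    inner ℝ (superposition hf v) w = ∫ x, f (v x) * w x ∂μ := by
  rw [L2.inner_def]
  refine integral_congr_ae ?_
  filter_upwards [coeFn_superposition hf v] with x hx
  rw [hx]
  simp [mul_comm]

end Superposition

/-! ### The bilinear forms on H¹₀(Ω) and the Rothe interpolant -/

section Sobolev

variable {d : ℕ} (Ω : Set (Rd d))

/-- The embedding of `H¹₀(Ω)` in `L²(Ω)`. -/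
noncomputable def toL2L : H01 Ω →L[ℝ] L2 Ω :=
  (WithLp.fstL 2 ℝ (L2 Ω) (L2Vec Ω)) ∘L (H01 Ω).subtypeL

/-- The gradient as a continuous linear map. -/
noncomputable def gradL : H01 Ω →L[ℝ] L2Vec Ω :=
  (WithLp.sndL 2 ℝ (L2 Ω) (L2Vec Ω)) ∘L (H01 Ω).subtypeL

variable {Ω}

theorem toL2L_apply (v : H01 Ω) : toL2L Ω v = toL2 v := rfl

theorem norm_sq_eq_toL2L_add_gradL (v : H01 Ω) :
    ‖v‖ ^ 2 = ‖toL2L Ω v‖ ^ 2 + ‖gradL Ω v‖ ^ 2 :=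
  WithLp.prod_norm_sq_eq_of_L2 (v : L2Pair Ω)

theorem norm_toL2_le (v : H01 Ω) : ‖toL2 v‖ ≤ ‖v‖ := by
  refine le_of_sq_le_sq ?_ (norm_nonneg _)
  rw [norm_sq_eq_toL2L_add_gradL v, toL2L_apply]
  exact le_add_of_nonneg_right (sq_nonneg _)

instance : CompleteSpace (H01 Ω) :=
  (Submodule.isClosed_topologicalClosure _).completeSpace_coe

variable (Ω) in
/-- The operator of the form `(a v, w)` on `H¹₀(Ω)`. -/
noncomputable def massL : LInf Ω →L[ℝ] (H01 Ω →L[ℝ] H01 Ω) :=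
  sandwichL (toL2L Ω) ∘L mulL _ ℝ

variable (Ω) in
/-- The operator of the form `(a ∇v, ∇w)` on `H¹₀(Ω)`. -/
noncomputable def stiffnessL : LInf Ω →L[ℝ] (H01 Ω →L[ℝ] H01 Ω) :=
  sandwichL (gradL Ω) ∘L mulL _ (Rd d)

theorem inner_massL (a : LInf Ω) (v w : H01 Ω) :
    inner ℝ (massL Ω a v) w = inner ℝ (a • toL2 v : L2 Ω) (toL2 w) := by
  rw [← mulL_apply]
  exact inner_sandwichL (toL2L Ω) _ v w

theorem inner_stiffnessL (a : LInf Ω) (v w : H01 Ω) :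
    inner ℝ (stiffnessL Ω a v) w = inner ℝ (a • grad v : L2Vec Ω) (grad w) := by
  rw [← mulL_apply]
  exact inner_sandwichL (gradL Ω) _ v w

/-- The mass term controls the L² part of the norm and the stiffness term the gradient part, so no
Poincaré inequality is involved. -/
theorem coercive_massL_add_stiffnessL {a b : LInf Ω} {c c' : ℝ}
    (ha : ∀ᵐ x ∂volume.restrict Ω, c ≤ a x) (hb : ∀ᵐ x ∂volume.restrict Ω, c' ≤ b x) (v : H01 Ω) :
    min c c' * ‖v‖ ^ 2 ≤ inner ℝ ((massL Ω a + stiffnessL Ω b) v) v := by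
  have h1 : c * ‖toL2L Ω v‖ ^ 2 ≤ inner ℝ (massL Ω a v) v :=
    (mul_norm_sq_le_inner_mulL ha (toL2L Ω v)).trans_eq (inner_sandwichL (toL2L Ω) _ v v).symm
  have h2 : c' * ‖gradL Ω v‖ ^ 2 ≤ inner ℝ (stiffnessL Ω b v) v :=
    (mul_norm_sq_le_inner_mulL hb (gradL Ω v)).trans_eq (inner_sandwichL (gradL Ω) _ v v).symm
  rw [norm_sq_eq_toL2L_add_gradL, _root_.add_apply, inner_add_left, mul_add]
  refine add_le_add (le_trans ?_ h1) (le_trans ?_ h2)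
  · gcongr; exact min_le_left _ _
  · gcongr; exact min_le_right _ _

theorem inner_stiffnessL_self_nonneg {b : LInf Ω} (hb : ∀ᵐ x ∂volume.restrict Ω, 0 ≤ b x)
    (v : H01 Ω) : 0 ≤ inner ℝ (stiffnessL Ω b v) v := by
  have := (mul_norm_sq_le_inner_mulL hb (gradL Ω v)).trans_eq (inner_sandwichL (gradL Ω) _ v v).symm
  rwa [zero_mul] at this

/-- The piecewise affine interpolant is close to `u` if it is so at the nodes. -/
theorem norm_rotheFunction_sub_le {T : ℝ} (hT : 0 < T) {n : ℕ} (hn : 1 ≤ n) {z : ℕ → H01 Ω}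
    {u : ℝ → H01 Ω} {ε : ℝ} (hz : ∀ i ≤ n, ‖z i - u (i * (T / n))‖ ≤ ε)
    (hu : ∀ s ∈ Icc 0 T, ∀ t ∈ Icc 0 T, |s - t| ≤ T / n → ‖u s - u t‖ ≤ ε) {t : ℝ}
    (ht : t ∈ Icc 0 T) : ‖rotheFunction T n z t - u t‖ ≤ ε + ε := by
  have hn0 : (0 : ℝ) < n := by exact_mod_cast hn
  -- One ε is the nodal error, the other the oscillation of `u` over one time step.
  have hnode : ∀ i ≤ n, |(i : ℝ) * (T / n) - t| ≤ T / n → ‖z i - u t‖ ≤ ε + ε := fun i hi h => by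
    have hi' : (i : ℝ) * (T / n) ∈ Icc 0 T := ⟨by positivity, by
      have : (i : ℝ) ≤ n := by exact_mod_cast hi
      calc (i : ℝ) * (T / n) ≤ n * (T / n) := by gcongr
        _ = T := by field_simp⟩
    have := norm_add_le_of_le (hz i hi) (hu _ hi' t ht h)
    rwa [sub_add_sub_cancel] at this
  have hτ0 : 0 < T / n := by positivity
  rw [rotheFunction]
  rcases le_or_gt t 0 with h0 | h0
  · simp only [if_pos h0]
    have ht0 : t = 0 := le_antisymm h0 ht.1
    exact_mod_cast hnode 0 (Nat.zero_le n) (by simp [ht0, hτ0.le])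
  · simp only [if_neg h0.not_ge]
    set τ := T / n with hτ
    set i := ⌈t / τ⌉₊ with hi
    have hi1 : 1 ≤ i := Nat.one_le_iff_ne_zero.2 (Nat.ceil_pos.2 (by positivity)).ne'
    have hin : i ≤ n := Nat.ceil_le.2 (by
      rw [div_le_iff₀ hτ0, hτ]; field_simp; exact ht.2)
    have h1 : t ≤ i * τ := by rw [← div_le_iff₀ hτ0]; exact Nat.le_ceil _
    have h2 : ((i : ℝ) - 1) * τ < t := by
      rw [← lt_div_iff₀ hτ0]
      linarith [Nat.ceil_lt_add_one (show 0 ≤ t / τ by positivity)]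
    have hc : ((i - 1 : ℕ) : ℝ) = (i : ℝ) - 1 := by push_cast [hi1]; ring
    have b1 := hnode i hin (by rw [abs_le]; constructor <;> nlinarith)
    have b2 := hnode (i - 1) (by omega) (by rw [hc, abs_le]; constructor <;> nlinarith)
    set θ := (t - ((i : ℝ) - 1) * τ) * τ⁻¹ with hθ
    have hθ0 : 0 ≤ θ := mul_nonneg (by linarith) (by positivity)
    have hθ1 : θ ≤ 1 := by
      rw [hθ, ← div_eq_mul_inv, div_le_one hτ0]; linarith
    rw [smul_smul]
    -- The interpolant is a convex combination of two adjacent iterates, both of whose nodes lie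
    -- within τ of `t`.
    have e : z (i - 1) + θ • (z i - z (i - 1)) - u t =
        (1 - θ) • (z (i - 1) - u t) + θ • (z i - u t) := by module
    rw [e]
    calc _ ≤ (1 - θ) * (ε + ε) + θ * (ε + ε) := by
          refine norm_add_le_of_le ?_ ?_
          · rw [norm_smul, Real.norm_of_nonneg (by linarith)]
            exact mul_le_mul_of_nonneg_left b2 (by linarith)
          · rw [norm_smul, Real.norm_of_nonneg hθ0]
            exact mul_le_mul_of_nonneg_left b1 hθ0
      _ = ε + ε := by ring

end Sobolev

end PseudoParabolic

/-! ### The weak problem as an evolution equation in H¹₀(Ω) -/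

namespace PseudoParabolic

variable {d : ℕ} {Ω : Set (Rd d)}

variable (Ω) in
/-- The Riesz representation in `H¹₀(Ω)` of the functional `(g, ·)`, for `g ∈ L²(Ω)`. -/
noncomputable def loadL : L2 Ω →L[ℝ] H01 Ω := (toL2L Ω).adjoint

theorem inner_loadL (g : L2 Ω) (v : H01 Ω) : inner ℝ (loadL Ω g) v = inner ℝ g (toL2 v) :=
  ContinuousLinearMap.adjoint_inner_left _ _ _

/-- The solution operator of `(a v, ·) + (b ∇v, ∇·) = (w, ·)_{H¹}`. -/
noncomputable def resolvent (a b : LInf Ω) : H01 Ω →L[ℝ] H01 Ω :=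
  Ring.inverse (massL Ω a + stiffnessL Ω b)

theorem continuousOn_resolvent {s : Set ℝ} {ρ η : ℝ → LInf Ω} (hρ : ContinuousOn ρ s)
    (hη : ContinuousOn η s) (hu : ∀ t ∈ s, IsUnit (massL Ω (ρ t) + stiffnessL Ω (η t))) :
    ContinuousOn (fun t => resolvent (ρ t) (η t)) s :=
  continuousOn_inverse_add ((massL Ω).continuous.comp_continuousOn hρ)
    ((stiffnessL Ω).continuous.comp_continuousOn hη) hu

theorem hasDerivWithinAt_clm_comp {E G : Type*} [NormedAddCommGroup E] [NormedSpace ℝ E]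
    [NormedAddCommGroup G] [NormedSpace ℝ G] (J : E →L[ℝ] G) {w : ℝ → E} {w' : E} {s : Set ℝ}
    {t : ℝ} (h : HasDerivWithinAt w w' s t) : HasDerivWithinAt (fun t => J (w t)) (J w') s t :=
  J.hasFDerivAt.comp_hasDerivWithinAt t h

theorem memLp_top_of_continuousOn_Icc {E : Type*} [NormedAddCommGroup E] {a b : ℝ} {w : ℝ → E}
    (hw : ContinuousOn w (Icc a b)) : MemLp w ∞ (volume.restrict (Ioo a b)) := by
  obtain ⟨c, -, hc⟩ := exists_bound_of_continuousOn_Icc hw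
  refine memLp_top_of_bound ?_ c ((ae_restrict_iff' measurableSet_Ioo).2
    (Eventually.of_forall fun t ht => hc t (Ioo_subset_Icc_self ht)))
  rw [restrict_Ioo_eq_restrict_Icc]
  exact hw.aestronglyMeasurable_of_isCompact isCompact_Icc measurableSet_Icc

theorem memLp_clm_apply_add {V : Type*} [NormedAddCommGroup V] [NormedSpace ℝ V] {a b : ℝ}
    {S : ℝ → V →L[ℝ] V} (hS : ContinuousOn S (Icc a b)) {w g : ℝ → V}
    (hw : ContinuousOn w (Icc a b)) (hg : MemLp g 2 (volume.restrict (Ioo a b))) :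
    MemLp (fun s => S s (w s + g s)) 2 (volume.restrict (Ioo a b)) :=
  (ContinuousLinearMap.id ℝ (V →L[ℝ] V)).memLp_of_bilin 2 (memLp_top_of_continuousOn_Icc hS)
    (((memLp_top_of_continuousOn_Icc hw).mono_exponent le_top).add hg)

section Reaction

variable [IsFiniteMeasure (volume.restrict Ω)] {f : ℝ → ℝ} {L : ℝ≥0}

/-- The Riesz representation in `H¹₀(Ω)` of the functional `(f(v), ·)`. -/
noncomputable def reaction (hf : LipschitzWith L f) (v : H01 Ω) : H01 Ω :=
  loadL Ω (superposition hf (toL2 v))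

theorem inner_reaction (hf : LipschitzWith L f) (v w : H01 Ω) :
    inner ℝ (reaction hf v) w = ∫ x in Ω, f (toL2 v x) * toL2 w x := by
  rw [reaction, inner_loadL, inner_superposition]

theorem exists_lipschitzWith_reaction (hf : LipschitzWith L f) :
    ∃ C, LipschitzWith C (reaction (Ω := Ω) hf) :=
  ⟨_, (loadL Ω).lipschitz.comp ((lipschitzWith_superposition hf).comp (toL2L Ω).lipschitz)⟩

/-- The part of the velocity equation which is Lipschitz continuous in `v`. -/
noncomputable def drift (hf : LipschitzWith L f) (ρ' κ : LInf Ω) (v : H01 Ω) : H01 Ω :=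
  reaction hf v - stiffnessL Ω κ v - massL Ω ρ' v

theorem continuousOn_clm_apply_comp {V W X : Type*} [NormedAddCommGroup V] [NormedSpace ℝ V]
    [NormedAddCommGroup W] [NormedSpace ℝ W] [TopologicalSpace X] (J : W →L[ℝ] (V →L[ℝ] V))
    {w : X → W} {v : X → V} {s : Set X} (hw : ContinuousOn w s) (hv : ContinuousOn v s) :
    ContinuousOn (fun t => J (w t) (v t)) s :=
  (J.continuous.comp_continuousOn hw).clm_apply hv

theorem continuousOn_drift {X : Type*} [TopologicalSpace X] (hf : LipschitzWith L f)
    {ρ' κ : X → LInf Ω} {v : X → H01 Ω} {s : Set X} (hρ' : ContinuousOn ρ' s)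
    (hκ : ContinuousOn κ s) (hv : ContinuousOn v s) :
    ContinuousOn (fun t => drift hf (ρ' t) (κ t) (v t)) s := by
  obtain ⟨C, hC⟩ := exists_lipschitzWith_reaction (Ω := Ω) hf
  exact ((hC.continuous.comp_continuousOn hv).sub
    (continuousOn_clm_apply_comp (stiffnessL Ω) hκ hv)).sub
    (continuousOn_clm_apply_comp (massL Ω) hρ' hv)

/-- The variational equation at a fixed time is an explicit equation for the velocity `v'`. -/
theorem forall_variational_iff (hf : LipschitzWith L f) {ρ ρ' η κ : LInf Ω}
    (hu : IsUnit (massL Ω ρ + stiffnessL Ω η)) {v v' : H01 Ω} {F w : L2 Ω}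
    (hw : w = (ρ' • toL2 v : L2 Ω) + (ρ • toL2 v' : L2 Ω)) :
    (∀ φ : H01 Ω, inner ℝ w (toL2 φ) + inner ℝ (η • grad v' : L2Vec Ω) (grad φ)
          + inner ℝ (κ • grad v : L2Vec Ω) (grad φ)
        = (∫ x in Ω, f (toL2 v x) * toL2 φ x) + inner ℝ F (toL2 φ)) ↔
      resolvent ρ η (drift hf ρ' κ v + loadL Ω F) = v' := by
  rw [drift, resolvent, inverse_apply_eq_iff hu]
  -- The residual of the variational equation is the inner product of φ with the residual of the
  -- operator equation, so one vanishes for all φ exactly when the other is zero.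
  have key : ∀ φ : H01 Ω, inner ℝ w (toL2 φ) + inner ℝ (η • grad v' : L2Vec Ω) (grad φ)
          + inner ℝ (κ • grad v : L2Vec Ω) (grad φ)
          - ((∫ x in Ω, f (toL2 v x) * toL2 φ x) + inner ℝ F (toL2 φ)) =
      inner ℝ ((massL Ω ρ + stiffnessL Ω η) v') φ -
        inner ℝ (reaction hf v - stiffnessL Ω κ v - massL Ω ρ' v + loadL Ω F) φ := fun φ => by
    rw [hw, _root_.add_apply]
    simp only [inner_add_left, inner_sub_left, inner_massL, inner_stiffnessL, inner_reaction,
      inner_loadL]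
    ring
  constructor
  · intro h
    refine ext_inner_right ℝ fun φ => ?_
    have := key φ
    rw [h φ, sub_self] at this
    exact (sub_eq_zero.1 this.symm)
  · intro h φ
    have := key φ
    rw [h, sub_self] at this
    exact sub_eq_zero.1 this

/-- Since φ ranges over all of H¹₀(Ω), the variational identities are equalities of Riesz
representatives; the bounded map `loadL` commutes with the time integral of F. -/
theorem isRotheSequence_iff (hf : LipschitzWith L f) {T : ℝ} (hT : 0 < T) {ρ η κ : ℝ → LInf Ω}
    {F : ℝ → L2 Ω} (hF : IntervalIntegrable F volume 0 T) {u₀ : H01 Ω} {n : ℕ}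
    {z : ℕ → H01 Ω} :
    IsRotheSequence Ω T ρ η κ f F u₀ n z ↔ z 0 = u₀ ∧ ∀ i < n,
      (T / n)⁻¹ • (massL Ω (ρ ((i + 1 : ℕ) * (T / n))) (z (i + 1)) -
          massL Ω (ρ (i * (T / n))) (z i)) +
        stiffnessL Ω (η ((i + 1 : ℕ) * (T / n))) ((T / n)⁻¹ • (z (i + 1) - z i)) +
        stiffnessL Ω (κ ((i + 1 : ℕ) * (T / n))) (z (i + 1)) =
      reaction hf (z i) + (T / n)⁻¹ • ∫ s in (i * (T / n))..((i + 1 : ℕ) * (T / n)),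
        loadL Ω (F s) := by
  rw [IsRotheSequence]
  refine and_congr_right fun _ => forall₂_congr fun i hi => ?_
  have hn0 : (0 : ℝ) < n := by exact_mod_cast (Nat.zero_le i).trans_lt hi
  have hFi : IntervalIntegrable F volume (i * (T / n)) ((i + 1 : ℕ) * (T / n)) := by
    refine hF.mono_set (uIcc_subset_uIcc ?_ ?_)
    all_goals
      rw [uIcc_of_le hT.le]
      refine ⟨by positivity, ?_⟩
      rw [mul_div_left_comm]
      refine mul_le_of_le_one_right hT.le ((div_le_one hn0).2 ?_)
      exact_mod_cast (by omega)
  rw [ContinuousLinearMap.intervalIntegral_comp_comm _ hFi]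
  have e : ∀ x y : H01 Ω, x = y ↔ ∀ φ, inner ℝ x φ = inner ℝ y φ := fun x y =>
    ⟨fun h φ => by rw [h], ext_inner_right ℝ⟩
  rw [e]
  refine forall_congr' fun φ => ?_
  have hs : ∀ (c : ℝ) (x : H01 Ω), inner ℝ (c • x) φ = c * inner ℝ x φ := fun c x =>
    real_inner_smul_left x φ c
  simp only [inner_add_left, inner_sub_left, hs, real_inner_smul_left, inner_massL, inner_stiffnessL,
    inner_reaction, inner_loadL]

end Reaction

/-- The product rule for `ρ u`, where `u` is a primitive with values in `H¹₀(Ω)`. -/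
theorem hasWeakTimeDeriv_smul_toL2 {T : ℝ} (hT : 0 < T) {ρ ρ' : ℝ → LInf Ω}
    (hρ : ∀ t ∈ Icc 0 T, HasDerivWithinAt ρ (ρ' t) (Icc 0 T) t) (hρ' : ContinuousOn ρ' (Icc 0 T))
    {u u' : ℝ → H01 Ω} {x : H01 Ω} (hi : IntervalIntegrable u' volume 0 T)
    (hu : ∀ t ∈ Icc 0 T, u t = x + ∫ s in (0 : ℝ)..t, u' s) :
    HasWeakTimeDeriv T (fun t => (ρ t • toL2 (u t) : L2 Ω))
      (fun t => (ρ' t • toL2 (u t) : L2 Ω) + (ρ t • toL2 (u' t) : L2 Ω)) := by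
  -- The coefficient enters through a bounded linear map into operators, which carries
  -- differentiability of ρ in L^∞ to the operator norm.
  let J : LInf Ω →L[ℝ] (H01 Ω →L[ℝ] L2 Ω) := precompL (toL2L Ω) ∘L mulL _ ℝ
  have hJ : ∀ (a : LInf Ω) (v : H01 Ω), J a v = (a • toL2 v : L2 Ω) := fun a v =>
    mulL_apply a (toL2 v)
  have hJρ : ∀ t ∈ Icc 0 T, HasDerivWithinAt (fun t => J (ρ t)) (J (ρ' t)) (Icc 0 T) t :=
    fun t ht => hasDerivWithinAt_clm_comp (G := H01 Ω →L[ℝ] L2 Ω) J (hρ t ht)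
  have := hasWeakTimeDeriv_clm_apply hT (J.continuous.comp_continuousOn hρ') hJρ hi hu
  simpa only [Function.comp_apply, hJ] using this

theorem hasWeakTimeDeriv_of_eq_primitive {E : Type*} [NormedAddCommGroup E] [NormedSpace ℝ E]
    [CompleteSpace E] {T : ℝ} (hT : 0 < T) {u w : ℝ → E} {x : E}
    (hw : IntervalIntegrable w volume 0 T)
    (hu : ∀ t ∈ Icc 0 T, u t = x + ∫ s in (0 : ℝ)..t, w s) : HasWeakTimeDeriv T u w := by
  have := hasWeakTimeDeriv_clm_apply hT (Ψ := fun _ => ContinuousLinearMap.id ℝ E)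
    (Ψ' := fun _ => 0) continuousOn_const (fun t _ => hasDerivWithinAt_const t _ _) hw hu
  simpa only [ContinuousLinearMap.id_apply, _root_.zero_apply, zero_add] using this

theorem intervalIntegral_congr_Ioo {E : Type*} [NormedAddCommGroup E] [NormedSpace ℝ E] {T t : ℝ}
    {v w : ℝ → E} (h : v =ᵐ[volume.restrict (Ioo 0 T)] w) (ht : t ∈ Icc 0 T) :
    ∫ s in (0 : ℝ)..t, v s = ∫ s in (0 : ℝ)..t, w s := by
  rw [intervalIntegral.integral_of_le ht.1, intervalIntegral.integral_of_le ht.1,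
    integral_Ioc_eq_integral_Ioo, integral_Ioc_eq_integral_Ioo]
  exact integral_congr_ae (ae_restrict_of_ae_restrict_of_subset (Ioo_subset_Ioo_right ht.2) h)

section Reaction

variable [IsFiniteMeasure (volume.restrict Ω)] {f : ℝ → ℝ} {L : ℝ≥0}

/-- The solution is the primitive of its velocity. The product rule and uniqueness of weak
derivatives identify ∂_t(ρu) with ρ'u + ρu' a.e., after which the variational equation can be solved
for the velocity. -/
theorem IsWeakSolution.eq_integral (hf : LipschitzWith L f) {T : ℝ} (hT : 0 < T)
    {ρ ρ' η κ : ℝ → LInf Ω}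
    (hρ : ∀ t ∈ Icc 0 T, HasDerivWithinAt ρ (ρ' t) (Icc 0 T) t) (hρ' : ContinuousOn ρ' (Icc 0 T))
    (hu : ∀ t ∈ Icc 0 T, IsUnit (massL Ω (ρ t) + stiffnessL Ω (η t)))
    {F : ℝ → L2 Ω} {u₀ : H01 Ω} {u : ℝ → H01 Ω} (h : IsWeakSolution Ω T ρ η κ f F u₀ u) :
    ∀ t ∈ Icc 0 T, u t = u₀ + ∫ s in (0 : ℝ)..t, resolvent (ρ s) (η s)
        (drift hf (ρ' s) (κ s) (u s) + loadL Ω (F s)) := by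
  obtain ⟨hc, h0, u', w', hu', -, hw', heq⟩ := h
  intro t ht
  have hp := hu'.eq_primitive hT hc
  have hae := hw'.ae_eq (hasWeakTimeDeriv_smul_toL2 hT hρ hρ'
    ((intervalIntegrable_iff_integrableOn_Ioo_of_le hT.le).2 hu'.2.1) hp)
  rw [hp t ht, h0]
  congr 1
  refine intervalIntegral_congr_Ioo ?_ ht
  filter_upwards [hae, heq, ae_restrict_mem measurableSet_Ioo] with s h1 h2 hs
  exact ((forall_variational_iff hf (hu s (Ioo_subset_Icc_self hs)) h1).1 h2).symm

/-- Supplies ∂_t u ∈ L²(0,T; H¹₀(Ω)): bounded operators act on the sum of a bounded function and a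
square integrable one. -/
theorem memLp_resolvent_drift (hf : LipschitzWith L f) {T : ℝ} {ρ ρ' η κ : ℝ → LInf Ω}
    (hρ : ContinuousOn ρ (Icc 0 T)) (hρ' : ContinuousOn ρ' (Icc 0 T))
    (hη : ContinuousOn η (Icc 0 T)) (hκ : ContinuousOn κ (Icc 0 T))
    (hu : ∀ t ∈ Icc 0 T, IsUnit (massL Ω (ρ t) + stiffnessL Ω (η t)))
    {F : ℝ → L2 Ω} (hF : MemLp F 2 (volume.restrict (Ioo 0 T))) {u : ℝ → H01 Ω}
    (hc : ContinuousOn u (Icc 0 T)) :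
    MemLp (fun s => resolvent (ρ s) (η s) (drift hf (ρ' s) (κ s) (u s) + loadL Ω (F s))) 2
      (volume.restrict (Ioo 0 T)) := by
  have hg : MemLp (fun s => loadL Ω (F s)) 2 (volume.restrict (Ioo 0 T)) :=
    (loadL Ω).comp_memLp' hF
  exact memLp_clm_apply_add (continuousOn_resolvent hρ hη hu) (continuousOn_drift hf hρ' hκ hc) hg

theorem isWeakSolution_of_eq_integral (hf : LipschitzWith L f) {T : ℝ} (hT : 0 < T)
    {ρ ρ' η κ : ℝ → LInf Ω}
    (hρ : ∀ t ∈ Icc 0 T, HasDerivWithinAt ρ (ρ' t) (Icc 0 T) t) (hρ' : ContinuousOn ρ' (Icc 0 T))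
    (hη : ContinuousOn η (Icc 0 T)) (hκ : ContinuousOn κ (Icc 0 T))
    (hu : ∀ t ∈ Icc 0 T, IsUnit (massL Ω (ρ t) + stiffnessL Ω (η t)))
    {F : ℝ → L2 Ω} (hF : MemLp F 2 (volume.restrict (Ioo 0 T))) {u₀ : H01 Ω} {u : ℝ → H01 Ω}
    (hc : ContinuousOn u (Icc 0 T))
    (hp : ∀ t ∈ Icc 0 T, u t = u₀ + ∫ s in (0 : ℝ)..t, resolvent (ρ s) (η s)
        (drift hf (ρ' s) (κ s) (u s) + loadL Ω (F s))) :
    IsWeakSolution Ω T ρ η κ f F u₀ u := by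
  have hm := memLp_resolvent_drift hf (fun t ht => (hρ t ht).continuousWithinAt) hρ' hη hκ hu hF hc
  have hi := (intervalIntegrable_iff_integrableOn_Ioo_of_le hT.le).2 (hm.integrable one_le_two)
  have h0 : u 0 = u₀ := by
    rw [hp 0 (left_mem_Icc.2 hT.le), intervalIntegral.integral_same, add_zero]
  refine ⟨hc, h0, _, _, hasWeakTimeDeriv_of_eq_primitive hT hi hp, hm,
    hasWeakTimeDeriv_smul_toL2 hT hρ hρ' hi hp, ?_⟩
  filter_upwards [ae_restrict_mem measurableSet_Ioo] with s hs
  exact (forall_variational_iff hf (hu s (Ioo_subset_Icc_self hs)) rfl).2 rfl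

end Reaction

end PseudoParabolic

/-! ### The Rothe scheme as an Euler method -/

namespace PseudoParabolic

theorem exists_unique_recursion {X : Type*} {n : ℕ} {P : ℕ → X → X → Prop}
    (hP : ∀ i < n, ∀ x, ∃! y, P i x y) (x₀ : X) :
    ∃ z : ℕ → X, (z 0 = x₀ ∧ ∀ i < n, P i (z i) (z (i + 1))) ∧
      ∀ y : ℕ → X, (y 0 = x₀ ∧ ∀ i < n, P i (y i) (y (i + 1))) → ∀ i ≤ n, y i = z i := by
  -- Beyond `n` the recursion is unconstrained and any value serves; uniqueness is accordingly
  -- claimed only for i ≤ n.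
  have hstep : ∀ i x, ∃ y, i < n → P i x y := fun i x => by
    by_cases hi : i < n
    · obtain ⟨y, hy, -⟩ := hP i hi x
      exact ⟨y, fun _ => hy⟩
    · exact ⟨x, fun h => absurd h hi⟩
  choose g hg using hstep
  refine ⟨fun i => Nat.rec x₀ g i, ⟨rfl, fun i hi => hg i _ hi⟩, fun y hy i => ?_⟩
  induction i with
  | zero => exact fun _ => hy.1
  | succ i ih =>
    intro hi
    have h1 := hy.2 i hi
    rw [ih (by omega)] at h1
    exact (hP i hi _).unique h1 (hg i _ hi)

theorem integral_const_sub_deriv_add {V : Type*} [NormedAddCommGroup V] [NormedSpace ℝ V]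
    [CompleteSpace V] {T a b : ℝ} {w w' g : ℝ → V} {c : V}
    (hw : ∀ t ∈ Icc 0 T, HasDerivWithinAt w (w' t) (Icc 0 T) t) (hw' : ContinuousOn w' (Icc 0 T))
    (hg : IntervalIntegrable g volume 0 T) (ha : a ∈ Icc 0 T) (hb : b ∈ Icc 0 T) (hab : a ≤ b) :
    ∫ s in a..b, (c - w' s + g s) = (b - a) • c - (w b - w a) + ∫ s in a..b, g s := by
  have hsub : Icc a b ⊆ Icc 0 T := Icc_subset_Icc ha.1 hb.2
  have hgi : IntervalIntegrable g volume a b := hg.mono_set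
    (by rwa [uIcc_of_le hab, uIcc_of_le (ha.1.trans ha.2)])
  have hR : IntervalIntegrable w' volume a b :=
    ContinuousOn.intervalIntegrable (by rw [uIcc_of_le hab]; exact hw'.mono hsub)
  have hint : ∫ s in a..b, w' s = w b - w a :=
    intervalIntegral.integral_eq_sub_of_hasDerivAt_of_le hab
      (fun t ht => ((hw t (hsub ht)).continuousWithinAt).mono hsub)
      (fun t ht => (hw t (hsub (Ioo_subset_Icc_self ht))).hasDerivAt
        (Icc_mem_nhds (ha.1.trans_lt ht.1) (ht.2.trans_le hb.2))) hR
  rw [intervalIntegral.integral_add (intervalIntegrable_const.sub hR) hgi,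
    intervalIntegral.integral_sub intervalIntegrable_const hR, intervalIntegral.integral_const, hint]

section Step

variable {V : Type*} [NormedAddCommGroup V] [NormedSpace ℝ V] {Q₀ Q₁ E K : V →L[ℝ] V} {τ : ℝ}
  {x y b γ : V}

/-- Isolates the new iterate. As f is evaluated at the old one, the step is linear, and its operator
will be coercive for every τ > 0. -/
theorem euler_step_iff :
    τ⁻¹ • (Q₁ y - Q₀ x) + E (τ⁻¹ • (y - x)) + K y = b + τ⁻¹ • γ ↔
      (τ⁻¹ • (Q₁ + E) + K) y = b + τ⁻¹ • (γ + Q₀ x + E x) := by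
  have : (τ⁻¹ • (Q₁ + E) + K) y - (b + τ⁻¹ • (γ + Q₀ x + E x)) =
      τ⁻¹ • (Q₁ y - Q₀ x) + E (τ⁻¹ • (y - x)) + K y - (b + τ⁻¹ • γ) := by
    simp only [_root_.add_apply, _root_.smul_apply, map_smul, map_sub]
    module
  rw [← sub_eq_zero, ← this, sub_eq_zero]

/-- Splitting Q₁y - Q₀x = Q₁(y - x) + (Q₁ - Q₀)x leaves Q₁ + E acting on the increment alone. -/
theorem euler_increment_eq (hτ : τ ≠ 0) (hu : IsUnit (Q₁ + E))
    (h : τ⁻¹ • (Q₁ y - Q₀ x) + E (τ⁻¹ • (y - x)) + K y = b + τ⁻¹ • γ) :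
    y - x = Ring.inverse (Q₁ + E) (τ • (b - K y) - (Q₁ x - Q₀ x) + γ) := by
  refine ((inverse_apply_eq_iff hu).2 ?_).symm
  have h1 : τ • (τ⁻¹ • (Q₁ y - Q₀ x) + E (τ⁻¹ • (y - x)) + K y) = τ • (b + τ⁻¹ • γ) := by rw [h]
  simp only [map_smul, smul_add, smul_smul, mul_inv_cancel₀ hτ, one_smul] at h1
  have h2 : γ = Q₁ y - Q₀ x + E (y - x) + τ • K y - τ • b := by rw [h1]; abel
  rw [h2, _root_.add_apply, map_sub, smul_sub]
  abel

end Step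

variable {d : ℕ} {Ω : Set (Rd d)} [IsFiniteMeasure (volume.restrict Ω)] {f : ℝ → ℝ} {L : ℝ≥0}

theorem isUnit_smul_add_of_coercive {V : Type*} [NormedAddCommGroup V] [InnerProductSpace ℝ V]
    [CompleteSpace V] {A K : V →L[ℝ] V} {c r : ℝ} (hc : 0 < c) (hr : 0 < r)
    (hA : ∀ v, c * ‖v‖ ^ 2 ≤ inner ℝ (A v) v) (hK : ∀ v, 0 ≤ inner ℝ (K v) v) :
    IsUnit (r • A + K) := by
  refine isUnit_of_coercive (mul_pos hr hc) fun v => ?_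
  rw [_root_.add_apply, _root_.smul_apply, inner_add_left, real_inner_smul_left, mul_assoc]
  exact le_add_of_le_of_nonneg (mul_le_mul_of_nonneg_left (hA v) hr.le) (hK v)

theorem node_mem_Icc {T : ℝ} (hT : 0 < T) {n i : ℕ} (hn : 1 ≤ n) (hi : i ≤ n) :
    (i : ℝ) * (T / n) ∈ Icc 0 T := by
  have hn0 : (0 : ℝ) < n := by exact_mod_cast hn
  refine ⟨by positivity, ?_⟩
  rw [mul_div_left_comm]
  exact mul_le_of_le_one_right hT.le ((div_le_one hn0).2 (by exact_mod_cast hi))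

/-- The time-discrete problems have exactly one solution. -/
theorem exists_unique_isRotheSequence (hf : LipschitzWith L f) {T : ℝ} (hT : 0 < T)
    {ρ η κ : ℝ → LInf Ω} {c : ℝ} (hc : 0 < c)
    (hA : ∀ t ∈ Icc 0 T, ∀ v, c * ‖v‖ ^ 2 ≤ inner ℝ ((massL Ω (ρ t) + stiffnessL Ω (η t)) v) v)
    (hK : ∀ t ∈ Icc 0 T, ∀ v, 0 ≤ inner ℝ (stiffnessL Ω (κ t) v) v)
    {F : ℝ → L2 Ω} (hF : IntervalIntegrable F volume 0 T) (u₀ : H01 Ω) {n : ℕ} (hn : 1 ≤ n) :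
    ∃ z : ℕ → H01 Ω, IsRotheSequence Ω T ρ η κ f F u₀ n z ∧
      ∀ y : ℕ → H01 Ω, IsRotheSequence Ω T ρ η κ f F u₀ n y → ∀ i ≤ n, y i = z i := by
  simp only [isRotheSequence_iff hf hT hF]
  refine exists_unique_recursion (P := fun i x y =>
      (T / n)⁻¹ • (massL Ω (ρ ((i + 1 : ℕ) * (T / n))) y - massL Ω (ρ (i * (T / n))) x) +
        stiffnessL Ω (η ((i + 1 : ℕ) * (T / n))) ((T / n)⁻¹ • (y - x)) +
        stiffnessL Ω (κ ((i + 1 : ℕ) * (T / n))) y =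
      reaction hf x + (T / n)⁻¹ • ∫ s in (i * (T / n))..((i + 1 : ℕ) * (T / n)), loadL Ω (F s))
    (fun i hi x => ?_) u₀
  have hn0 : (0 : ℝ) < n := by exact_mod_cast hn
  have ht := node_mem_Icc hT hn (Nat.succ_le_of_lt hi)
  have hu := isUnit_smul_add_of_coercive hc (show 0 < (T / n)⁻¹ by positivity) (hA _ ht) (hK _ ht)
  refine ⟨_, euler_step_iff.2 ((inverse_apply_eq_iff hu).1 rfl), fun y hy => ?_⟩
  exact ((inverse_apply_eq_iff hu).2 (euler_step_iff.1 hy)).symm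

/-- The form required by `exists_euler_error_le`. The difference of ρ between nodes, acting on the
old iterate, is the exact integral of ρ' over the step. -/
theorem IsRotheSequence.increment_eq (hf : LipschitzWith L f) {T : ℝ} (hT : 0 < T)
    {ρ ρ' η κ : ℝ → LInf Ω}
    (hρ : ∀ t ∈ Icc 0 T, HasDerivWithinAt ρ (ρ' t) (Icc 0 T) t) (hρ' : ContinuousOn ρ' (Icc 0 T))
    (hu : ∀ t ∈ Icc 0 T, IsUnit (massL Ω (ρ t) + stiffnessL Ω (η t)))
    {F : ℝ → L2 Ω} (hF : IntervalIntegrable F volume 0 T) {u₀ : H01 Ω} {n : ℕ} {z : ℕ → H01 Ω}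
    (h : IsRotheSequence Ω T ρ η κ f F u₀ n z) {i : ℕ} (hi : i < n) :
    z (i + 1) - z i = resolvent (ρ ((i + 1 : ℕ) * (T / n))) (η ((i + 1 : ℕ) * (T / n)))
      (∫ s in (i * (T / n))..((i + 1 : ℕ) * (T / n)), (reaction hf (z i) -
        stiffnessL Ω (κ ((i + 1 : ℕ) * (T / n))) (z (i + 1)) - massL Ω (ρ' s) (z i) +
        loadL Ω (F s))) := by
  have hn : 1 ≤ n := by omega
  have hn0 : (0 : ℝ) < n := by exact_mod_cast hn
  have h1 := ((isRotheSequence_iff hf hT hF).1 h).2 i hi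
  have ha := node_mem_Icc hT hn hi.le
  have hb : ((i + 1 : ℕ) : ℝ) * (T / n) ∈ Icc 0 T := node_mem_Icc hT hn hi
  have hle : (i : ℝ) * (T / n) ≤ (i + 1 : ℕ) * (T / n) := by gcongr; simp
  rw [euler_increment_eq (by positivity) (hu _ hb) h1, resolvent]
  congr 1
  have hFi : IntervalIntegrable (fun s => loadL Ω (F s)) volume 0 T :=
    ⟨(loadL Ω).integrable_comp hF.1, (loadL Ω).integrable_comp hF.2⟩
  have hd : ∀ t ∈ Icc 0 T, HasDerivWithinAt (fun s => massL Ω (ρ s) (z i)) (massL Ω (ρ' t) (z i))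
      (Icc 0 T) t := fun t ht => hasDerivWithinAt_clm_comp ((massL Ω).flip (z i)) (hρ t ht)
  have hRc := continuousOn_clm_apply_comp (massL Ω) hρ' (continuousOn_const (c := z i))
  have hτ : ((i + 1 : ℕ) : ℝ) * (T / n) - i * (T / n) = T / n := by push_cast; ring
  have hI := integral_const_sub_deriv_add
    (c := reaction hf (z i) - stiffnessL Ω (κ ((i + 1 : ℕ) * (T / n))) (z (i + 1)))
    hd hRc hFi ha hb hle
  rw [hτ] at hI
  exact hI.symm

end PseudoParabolic

/-! ### The abstract evolution equation and the main theorem -/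

namespace PseudoParabolic

/-- Global existence and uniqueness for `u' = S (N u - K u - R u + g)` in integral form. -/
theorem exists_unique_evolution {V : Type*} [NormedAddCommGroup V] [NormedSpace ℝ V]
    [CompleteSpace V] {T : ℝ} (hT : 0 < T) {S K R : ℝ → V →L[ℝ] V}
    (hS : ContinuousOn S (Icc 0 T)) (hK : ContinuousOn K (Icc 0 T)) (hR : ContinuousOn R (Icc 0 T))
    {N : V → V} {L : ℝ≥0} (hN : LipschitzWith L N) {g : ℝ → V}
    (hg : IntervalIntegrable g volume 0 T) (u₀ : V) :
    ∃ u : ℝ → V, ContinuousOn u (Icc 0 T) ∧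
      (∀ t ∈ Icc 0 T, u t = u₀ + ∫ s in (0 : ℝ)..t,
        S s (N (u s) - K s (u s) - R s (u s) + g s)) ∧
      ∀ v : ℝ → V, ContinuousOn v (Icc 0 T) →
        (∀ t ∈ Icc 0 T, v t = u₀ + ∫ s in (0 : ℝ)..t,
          S s (N (v s) - K s (v s) - R s (v s) + g s)) → EqOn v u (Icc 0 T) := by
  obtain ⟨c, hc0, hc⟩ := exists_bound_of_continuousOn_Icc hS
  obtain ⟨k, hk0, hk⟩ := exists_bound_of_continuousOn_Icc hK
  obtain ⟨r, hr0, hr⟩ := exists_bound_of_continuousOn_Icc hR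
  -- The term S g is kept out of the Lipschitz part because g is only integrable in time; it becomes
  -- the inhomogeneity of the Picard problem.
  have hB : ContinuousOn (Function.uncurry fun (s : ℝ) (x : V) => S s (N x - K s x - R s x))
      (Icc 0 T ×ˢ univ) := by
    have hfst : MapsTo Prod.fst (Icc (0 : ℝ) T ×ˢ (univ : Set V)) (Icc 0 T) := fun p hp => hp.1
    have h1 := hS.comp continuousOn_fst hfst
    have h2 := hK.comp continuousOn_fst hfst
    have h3 := hR.comp continuousOn_fst hfst
    exact h1.clm_apply ((((hN.continuous.comp continuous_snd).continuousOn).sub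
      (h2.clm_apply continuousOn_snd)).sub (h3.clm_apply continuousOn_snd))
  have hL : ∀ t ∈ Icc 0 T, ∀ x y : V,
      ‖S t (N x - K t x - R t x) - S t (N y - K t y - R t y)‖ ≤ c * (L + k + r) * ‖x - y‖ := by
    intro t ht x y
    have e : S t (N x - K t x - R t x) - S t (N y - K t y - R t y) =
        S t ((N x - N y) - K t (x - y) - R t (x - y)) := by
      simp only [map_sub]; abel
    have h1 : ‖(N x - N y) - K t (x - y) - R t (x - y)‖ ≤
        L * ‖x - y‖ + k * ‖x - y‖ + r * ‖x - y‖ :=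
      norm_sub_le_of_le (norm_sub_le_of_le (hN.norm_sub_le x y)
        ((K t).le_of_opNorm_le (hk t ht) _)) ((R t).le_of_opNorm_le (hr t ht) _)
    rw [e]
    calc _ ≤ c * (L * ‖x - y‖ + k * ‖x - y‖ + r * ‖x - y‖) :=
          (S t).le_of_opNorm_le_of_le (hc t ht) h1
      _ = _ := by ring
  simpa only [← map_add] using
    exists_unique_integral_eq hT hB hL (intervalIntegrable_clm_apply hT.le hS hg) u₀

end PseudoParabolic

open PseudoParabolic in
theorem mainTheorem3 {d : ℕ} (Ω : Set (Rd d)) (hΩ : IsOpen Ω) (hΩb : Bornology.IsBounded Ω)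
    (T : ℝ) (hT : 0 < T)
    (ρ η κ : ℝ → LInf Ω) (f : ℝ → ℝ) (F : ℝ → L2 Ω) (u₀ : H01 Ω)
    (ρ₀ ρ₁ ρ₁' η₀ η₁ κ₀ κ₁ κ₁' : ℝ) (Lf : ℝ≥0)
    (hρ : ContDiffOn ℝ 1 ρ (Icc 0 T)) (hρ₀ : 0 < ρ₀)
    (hρb : ∀ t ∈ Icc 0 T, ∀ᵐ x ∂(volume.restrict Ω), ρ₀ ≤ ρ t x ∧ ρ t x ≤ ρ₁)
    (hρ' : ∀ t ∈ Icc 0 T, ∀ᵐ x ∂(volume.restrict Ω), |derivWithin ρ (Icc 0 T) t x| ≤ ρ₁')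
    (hη : ContinuousOn η (Icc 0 T)) (hη₀ : 0 < η₀)
    (hηb : ∀ t ∈ Icc 0 T, ∀ᵐ x ∂(volume.restrict Ω), η₀ ≤ η t x ∧ η t x ≤ η₁)
    (hκ : ContDiffOn ℝ 1 κ (Icc 0 T)) (hκ₀ : 0 < κ₀)
    (hκb : ∀ t ∈ Icc 0 T, ∀ᵐ x ∂(volume.restrict Ω), κ₀ ≤ κ t x ∧ κ t x ≤ κ₁)
    (hκ' : ∀ t ∈ Icc 0 T, ∀ᵐ x ∂(volume.restrict Ω), |derivWithin κ (Icc 0 T) t x| ≤ κ₁')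
    (hf : LipschitzWith Lf f)
    (hF : MemLp F 2 (volume.restrict (Ioo 0 T))) :
    (∃ u : ℝ → H01 Ω, IsWeakSolution Ω T ρ η κ f F u₀ u ∧
      (∀ v : ℝ → H01 Ω, IsWeakSolution Ω T ρ η κ f F u₀ v → EqOn v u (Icc 0 T)) ∧
      ∀ z : ℕ → ℕ → H01 Ω,
        (∀ n : ℕ, 1 ≤ n → IsRotheSequence Ω T ρ η κ f F u₀ n (z n)) →
        TendstoUniformlyOn (fun n t => toL2 (rotheFunction T n (z n) t)) (fun t => toL2 (u t))
          atTop (Icc 0 T)) ∧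
    ∀ n : ℕ, 1 ≤ n →
      ∃ z : ℕ → H01 Ω, IsRotheSequence Ω T ρ η κ f F u₀ n z ∧
        ∀ y : ℕ → H01 Ω, IsRotheSequence Ω T ρ η κ f F u₀ n y → ∀ i ≤ n, y i = z i := by
  have : IsFiniteMeasure (volume.restrict Ω) :=
    isFiniteMeasure_restrict.2 hΩb.measure_lt_top.ne
  have hρd : ∀ t ∈ Icc 0 T, HasDerivWithinAt ρ (derivWithin ρ (Icc 0 T) t) (Icc 0 T) t :=
    fun t ht => (hρ.differentiableOn one_ne_zero t ht).hasDerivWithinAt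
  have hρc : ContinuousOn (derivWithin ρ (Icc 0 T)) (Icc 0 T) :=
    hρ.continuousOn_derivWithin (uniqueDiffOn_Icc hT) le_rfl
  have hκc : ContinuousOn κ (Icc 0 T) := hκ.continuousOn
  have hc0 : 0 < min ρ₀ η₀ := lt_min hρ₀ hη₀
  have hA : ∀ t ∈ Icc 0 T, ∀ v : H01 Ω,
      min ρ₀ η₀ * ‖v‖ ^ 2 ≤ inner ℝ ((massL Ω (ρ t) + stiffnessL Ω (η t)) v) v := fun t ht =>
    coercive_massL_add_stiffnessL ((hρb t ht).mono fun _ h => h.1) ((hηb t ht).mono fun _ h => h.1)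
  have hK : ∀ t ∈ Icc 0 T, ∀ v : H01 Ω, 0 ≤ inner ℝ (stiffnessL Ω (κ t) v) v := fun t ht =>
    inner_stiffnessL_self_nonneg ((hκb t ht).mono fun _ h => hκ₀.le.trans h.1)
  have hu : ∀ t ∈ Icc 0 T, IsUnit (massL Ω (ρ t) + stiffnessL Ω (η t)) := fun t ht =>
    isUnit_of_coercive hc0 (hA t ht)
  have hFi : IntervalIntegrable F volume 0 T :=
    (intervalIntegrable_iff_integrableOn_Ioo_of_le hT.le).2 (hF.integrable one_le_two)
  refine ⟨?_, fun n hn => exists_unique_isRotheSequence hf hT hc0 hA hK hFi u₀ hn⟩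
  obtain ⟨C, hC⟩ := exists_lipschitzWith_reaction (Ω := Ω) hf
  have hS := continuousOn_resolvent hρ.continuousOn hη hu
  have hKc : ContinuousOn (fun t => stiffnessL Ω (κ t)) (Icc 0 T) :=
    (stiffnessL Ω).continuous.comp_continuousOn hκc
  have hRc : ContinuousOn (fun t => massL Ω (derivWithin ρ (Icc 0 T) t)) (Icc 0 T) :=
    (massL Ω).continuous.comp_continuousOn hρc
  have hg : IntervalIntegrable (fun s => loadL Ω (F s)) volume 0 T :=
    ⟨(loadL Ω).integrable_comp hFi.1, (loadL Ω).integrable_comp hFi.2⟩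
  obtain ⟨u, huc, hue, huniq⟩ := exists_unique_evolution hT hS hKc hRc hC hg u₀
  have hu0 : u 0 = u₀ := by
    rw [hue 0 (left_mem_Icc.2 hT.le), intervalIntegral.integral_same, add_zero]
  refine ⟨u, isWeakSolution_of_eq_integral hf hT hρd hρc hη hκc hu hF huc hue,
    fun v hv => huniq v hv.1 (hv.eq_integral hf hT hρd hρc hu), fun z hz => ?_⟩
  rw [Metric.tendstoUniformlyOn_iff]
  intro ε hε
  -- One ε/3 bounds the nodal error and another the oscillation of `u` over a step; the remaining
  -- third makes the inequality strict.
  obtain ⟨n₁, hn₁⟩ := exists_euler_error_le hT hS hKc hRc hC hg huc (by rwa [hu0])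
    (show 0 < ε / 3 by positivity)
  obtain ⟨δ, hδ, hδu⟩ := exists_forall_dist_lt_of_continuousOn_Icc huc
    (show 0 < ε / 3 by positivity)
  obtain ⟨n₂, hn₂⟩ := exists_nat_gt (T / δ)
  filter_upwards [eventually_ge_atTop n₁, eventually_ge_atTop n₂, eventually_ge_atTop 1]
    with n h1 h2 h3 t ht
  have hn0 : (0 : ℝ) < n := by exact_mod_cast h3
  have hτ : T / n < δ := by
    rw [div_lt_comm₀ hn0 hδ]
    exact hn₂.trans_le (by exact_mod_cast h2)
  have hz0 : z n 0 = u 0 := (hz n h3).1.trans hu0.symm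
  have hnode := hn₁ n h1 (z n) hz0 fun i hi =>
    (hz n h3).increment_eq hf hT hρd hρc hu hFi hi
  have hmain := norm_rotheFunction_sub_le hT h3 hnode
    (fun s hs t ht hst => hδu s hs t ht (hst.trans_lt hτ)) ht
  rw [dist_comm, dist_eq_norm]
  calc ‖toL2 (rotheFunction T n (z n) t) - toL2 (u t)‖
      = ‖toL2 (rotheFunction T n (z n) t - u t)‖ := rfl
    _ ≤ ‖rotheFunction T n (z n) t - u t‖ := norm_toL2_le _
    _ ≤ ε / 3 + ε / 3 := hmain
    _ < ε := by linarith
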